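/- **Setting.** Let $k:\mathbb R^d\times\mathbb R^d\to[0,1]$ be a kernel, $P=\{x_1,\dots,x_n\}\subset\mathbb R^d$ ($n\ge 1$) a dataset and $\mathcal Q\subseteq\mathbb R^d$ a set of admissible queries (for instance $\mathcal Q=\mathbb R^d$, or all $x$ with $\mathrm{diam}(P\cup\{x\})\le R$). Write $w_i(x)=k(x,x_i)$ and $\mathrm{KDE}_P(x)=\frac1n\sum_i w_i(x)$. *Hashing-based estimator (HBE).* Let $h$ be drawn from a probability distribution $\nu$ on a collection of hash functions on $\mathbb R^d$. Put $p(x,y)=\Pr_h[h(x)=h(y)]$, $p_i(x)=p(x,x_i)$, and $H(x)=\{i: h(x_i)=h(x)\}$. The HBE is $Z_h(x)=\frac1n\,\frac{k(x,x_I)}{p(x,x_I)}\,|H(x)|$ with $I$ uniform in $H(x)$, and $Z_h(x)=0$ if $H(x)=\emptyset$. It is $(\beta,M)$-scale free ($M\ge1$) if $M^{-1}w_i(x)^\beta\le p_i(x)\le M\,w_i(x)^\beta$ for all $i$ and all $x\in\mathcal Q$. *Machine.* Algorithms run on a real RAM with unit-cost steps: arithmetic, floor, comparisons, indirect addressing,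 bounded while loops, subroutine calls (each call with fresh blank local memory), uniformly random integers, and an arbitrary fixed set of further unit-cost real functions. They have read access to the stored data and to the coordinates of the query. Space is the number of memory cells stored. The HBE has complexity $T$ (an integer $T\ge1$) if for every $h$ a table can be stored in at most $T n$ cells such that a program $E$, not depending on $h$, given this table and any query $x\in\mathcal Q$, outputs a sample of $Z_h(x)$ (given $h$) in at most $T$ steps. **Theorem.** There is an absolute constant $C>0$ such that the following holds. Suppose that for $k$, $P$ and $\mathcal Q$ there is a $(\frac12,M)$-scale-free HBE of complexity $T$, and let $\tau,\varepsilon,\delta\in(0,1]$. Write $$B(\mu)=C\,M^3\,\frac1{\varepsilon^2}\,\frac1{\sqrt\mu}\,\max\{1,\log(1/\delta)\}\,T .$$ Then there is a randomized data structure for $P$ that occupies at most $B(\tau)\,n$ cells and has the following properties. 1. For every $\mu\in[\tau,1]$ and every query $x\in\mathcal Q$ with $\mathrm{KDE}_P(x)=\mu$, with probability at least $1-\delta$ over the preprocessing and the query algorithm, the answer $\hat\mu$ satisfies $|\hat\mu-\mu|<\varepsilon\mu$ and is returned within $B(\mu)$ steps. 2. No query $x\in\mathcal Q$ ever takes more than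 $B(\tau)$ steps. Moreover, the query program depends only on the program $E$ that evaluates the HBE; the data and all parameters enter only through the stored memory. -/

import Mathlib

open MeasureTheory
open scoped ENNReal Classical

universe u v

noncomputable section

/-! ## The machine: a randomized real RAM with unit-cost steps -/

/-- A bank of memory cells, each holding a real number. Cells never written hold `0`. -/
abbrev Cells := ℕ → ℝ

/-- The binary operations of the machine: arithmetic, the floor of the first argument, and a set
`𝓕` of further unit-cost functions (such as `exp` or the Gaussian tail, depending on the kernels
that the machine has to handle). -/
inductive Op (𝓕 : Set (ℝ → ℝ → ℝ)) : Type
  | add | sub | mul | div | floor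
  | prim (f : 𝓕)

def Op.apply {𝓕 : Set (ℝ → ℝ → ℝ)} : Op 𝓕 → ℝ → ℝ → ℝ
  | .add, a, b => a + b
  | .sub, a, b => a - b
  | .mul, a, b => a * b
  | .div, a, b => a / b
  | .floor, a, _ => (⌊a⌋ : ℤ)
  | .prim f, a, b => f.1 a b

/-- Programs. A program works on private local cells (read and write), and it can read the stored
data structure and the coordinates of the query. A real number `r` that is used as an address,
a length or a count stands for the natural number `⌊r⌋₊`. Loops carry a bound, so that every run
terminates (a while loop within a known time bound is of this form). -/
inductive Prog (𝓕 : Set (ℝ → ℝ → ℝ)) : Type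
  /-- do nothing -/
  | skip
  /-- `local[dst] := c` -/
  | const (dst c : ℕ)
  /-- `local[dst] := f (local[a], local[b])` -/
  | op (f : Op 𝓕) (dst a b : ℕ)
  /-- `local[dst] := local[local[a]]` -/
  | get (dst a : ℕ)
  /-- `local[local[a]] := local[b]` -/
  | put (a b : ℕ)
  /-- `local[dst] := data[local[a]]` -/
  | load (dst a : ℕ)
  /-- `local[dst] := query[local[a]]` -/
  | input (dst a : ℕ)
  /-- `local[dst] :=` a fresh uniformly random element of `{0, 1, …, local[a]}` -/
  | rand (dst a : ℕ)
  /-- run `p`, then `q` -/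
  | seq (p q : Prog 𝓕)
  /-- run `p` if `local[a] ≤ local[b]`, else `q` -/
  | ite (a b : ℕ) (p q : Prog 𝓕)
  /-- repeat `p` while `local[b] ≠ 0`, at most `local[a]` times (`local[a]` is read once, on
  entering the loop) -/
  | loop (a b : ℕ) (p : Prog 𝓕)
  /-- run the subroutine `p` with blank local cells of its own, giving it as its data the
  `local[len]` data cells from address `local[base]` on; its result goes to `local[dst]` -/
  | call (dst base len : ℕ) (p : Prog 𝓕)

/-- `len` consecutive cells of `D`, from address `base` on. -/
def slice (D : Cells) (base len : ℕ) : Cells := fun i => if i < len then D (base + i) else 0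

/-- Iterate `body` while local cell `b` is nonzero, at most `m` times; every test of the loop
condition is one step. -/
def execLoop (body : Cells → PMF (Cells × ℕ)) (b : ℕ) : ℕ → Cells → PMF (Cells × ℕ)
  | 0, s => PMF.pure (s, 1)
  | m + 1, s =>
    if s b = 0 then PMF.pure (s, 1)
    else (body s).bind fun r =>
      (execLoop body b m r.1).map fun r' => (r'.1, 1 + r.2 + r'.2)

/-- The joint law of the final local cells and of the number of steps, when a program runs on
query `x` and data `D` from the local cells `s`. -/
def exec {𝓕 : Set (ℝ → ℝ → ℝ)} (x : Cells) : Prog 𝓕 → Cells → Cells → PMF (Cells × ℕ)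
  | .skip, _, s => PMF.pure (s, 1)
  | .const dst c, _, s => PMF.pure (Function.update s dst (c : ℝ), 1)
  | .op f dst a b, _, s => PMF.pure (Function.update s dst (f.apply (s a) (s b)), 1)
  | .get dst a, _, s => PMF.pure (Function.update s dst (s ⌊s a⌋₊), 1)
  | .put a b, _, s => PMF.pure (Function.update s ⌊s a⌋₊ (s b), 1)
  | .load dst a, D, s => PMF.pure (Function.update s dst (D ⌊s a⌋₊), 1)
  | .input dst a, _, s => PMF.pure (Function.update s dst (x ⌊s a⌋₊), 1)
  | .rand dst a, _, s =>
    (PMF.uniformOfFintype (Fin (⌊s a⌋₊ + 1))).map fun j =>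
      (Function.update s dst ((j : ℕ) : ℝ), 1)
  | .seq p q, D, s =>
    (exec x p D s).bind fun r => (exec x q D r.1).map fun r' => (r'.1, r.2 + r'.2)
  | .ite a b p q, D, s =>
    (if s a ≤ s b then exec x p D s else exec x q D s).map fun r => (r.1, 1 + r.2)
  | .loop a b p, D, s => execLoop (fun s' => exec x p D s') b ⌊s a⌋₊ s
  | .call dst base len p, D, s =>
    (exec x p (slice D ⌊s base⌋₊ ⌊s len⌋₊) 0).map fun r =>
      (Function.update s dst (r.1 0), 1 + r.2)

/-- The coordinates of a point, as the machine reads them. -/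
def coords {d : ℕ} (x : EuclideanSpace ℝ (Fin d)) : Cells :=
  fun i => if h : i < d then x ⟨i, h⟩ else 0

/-- The joint law of the output (local cell `0`) and of the running time of a program, run on
query `x` and data `D`. -/
def run {𝓕 : Set (ℝ → ℝ → ℝ)} {d : ℕ} (p : Prog 𝓕) (D : Cells) (x : EuclideanSpace ℝ (Fin d)) :
    PMF (ℝ × ℕ) :=
  (exec (coords x) p D 0).map fun r => (r.1 0, r.2)

/-- All cells of `D` from address `S` on are blank, so that `D` is stored in `S` cells. -/
def StoredIn (D : Cells) (S : ℕ) : Prop := ∀ a, S ≤ a → D a = 0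

/-! ## Kernel density and hashing-based estimators -/

section

variable {d n : ℕ}

/-- The kernel density of the points `P 0, …, P (n - 1)` at `x`. -/
def kde (k : EuclideanSpace ℝ (Fin d) → EuclideanSpace ℝ (Fin d) → ℝ)
    (P : Fin n → EuclideanSpace ℝ (Fin d)) (x : EuclideanSpace ℝ (Fin d)) : ℝ :=
  1 / (n : ℝ) * ∑ i, k x (P i)

variable {H : Type u} [MeasurableSpace H] {B : Type v}

/-- The probability that `x` and `y` collide under a random hash function `h ∼ ν`. -/
def collisionProb (ν : Measure H) (hash : H → EuclideanSpace ℝ (Fin d) → B)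
    (x y : EuclideanSpace ℝ (Fin d)) : ℝ :=
  ν.real {h | hash h y = hash h x}

/-- The (indices of the) data points in the cell of `x` in the hash table of `h`. -/
def bucket (hash : H → EuclideanSpace ℝ (Fin d) → B) (P : Fin n → EuclideanSpace ℝ (Fin d))
    (h : H) (x : EuclideanSpace ℝ (Fin d)) : Finset (Fin n) :=
  Finset.univ.filter fun i => hash h (P i) = hash h x

/-- The law, given `h`, of the hashing-based estimator `Z_h(x)`: for a uniformly random point `y`
of the cell of `x` it is `(1/n) (k(x,y)/p(x,y)) |H(x)|`, and it is `0` if the cell is empty. -/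
def hbeLaw (k : EuclideanSpace ℝ (Fin d) → EuclideanSpace ℝ (Fin d) → ℝ) (ν : Measure H)
    (hash : H → EuclideanSpace ℝ (Fin d) → B) (P : Fin n → EuclideanSpace ℝ (Fin d))
    (h : H) (x : EuclideanSpace ℝ (Fin d)) : PMF ℝ :=
  if hne : (bucket hash P h x).Nonempty then
    (PMF.uniformOfFinset (bucket hash P h x) hne).map fun i =>
      1 / (n : ℝ) * (k x (P i) / collisionProb ν hash x (P i)) * ((bucket hash P h x).card : ℝ)
  else PMF.pure 0

/-- The collision probabilities are well defined at the queries of `𝒬`. -/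
def MeasurableCollisions (hash : H → EuclideanSpace ℝ (Fin d) → B)
    (P : Fin n → EuclideanSpace ℝ (Fin d)) (𝒬 : Set (EuclideanSpace ℝ (Fin d))) : Prop :=
  ∀ x ∈ 𝒬, ∀ i, MeasurableSet {h | hash h (P i) = hash h x}

/-- The hashing-based estimator of the family `(hash, ν)` is `(β, M)`-scale free, for the queries
in `𝒬`. -/
def IsScaleFree (k : EuclideanSpace ℝ (Fin d) → EuclideanSpace ℝ (Fin d) → ℝ) (ν : Measure H)
    (hash : H → EuclideanSpace ℝ (Fin d) → B) (P : Fin n → EuclideanSpace ℝ (Fin d))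
    (𝒬 : Set (EuclideanSpace ℝ (Fin d))) (β M : ℝ) : Prop :=
  ∀ x ∈ 𝒬, ∀ i, M⁻¹ * k x (P i) ^ β ≤ collisionProb ν hash x (P i) ∧
    collisionProb ν hash x (P i) ≤ M * k x (P i) ^ β

/-- The hashing-based estimator of `(hash, ν)` has complexity `T`, by means of the program `E`:
for every hash function `h` one can store a table in `T * n` cells such that `E`, run on this
table, returns a sample of `Z_h(x)` within `T` steps, for every query `x ∈ 𝒬`. -/
def HasComplexity {𝓕 : Set (ℝ → ℝ → ℝ)} (E : Prog 𝓕)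
    (k : EuclideanSpace ℝ (Fin d) → EuclideanSpace ℝ (Fin d) → ℝ) (ν : Measure H)
    (hash : H → EuclideanSpace ℝ (Fin d) → B) (P : Fin n → EuclideanSpace ℝ (Fin d))
    (𝒬 : Set (EuclideanSpace ℝ (Fin d))) (T : ℕ) : Prop :=
  ∃ table : H → Cells, ∀ h, StoredIn (table h) (T * n) ∧ ∀ x ∈ 𝒬,
    (run E (table h) x).map Prod.fst = hbeLaw k ν hash P h x ∧
    ∀ r ∈ (run E (table h) x).support, r.2 ≤ T

end

/-! ## Data structures for the KDE problem -/

/-- The upper expectation of `f`. It is the expectation `∫⁻ ω, f ω ∂ℙ` if `f` is measurable. -/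
def upperExpectation {Ω : Type u} [MeasurableSpace Ω] (ℙ : Measure Ω) (f : Ω → ℝ≥0∞) : ℝ≥0∞ :=
  ⨅ (g : Ω → ℝ≥0∞) (_ : Measurable g) (_ : ∀ ω, f ω ≤ g ω), ∫⁻ ω, g ω ∂ℙ

/-- The data structure whose (random) preprocessing stores `image ω`, for `ω` drawn from `ℙ`, and
whose queries are answered by the program `A`, solves the `(μ, ε, δ)`-KDE problem for all
`μ ∈ [τ, 1]` in space `space`, in time `time μ` for a query of density `μ`.

The failure probability is over the preprocessing and the query together, and exceeding the time
`time μ` counts as a failure. The time `time τ` is never exceeded. As a step writes at most one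
local cell, this also bounds the working space of a query. -/
structure SolvesKDE {d n : ℕ} {𝓕 : Set (ℝ → ℝ → ℝ)} (A : Prog 𝓕)
    {Ω : Type u} [MeasurableSpace Ω] (ℙ : Measure Ω) (image : Ω → Cells)
    (k : EuclideanSpace ℝ (Fin d) → EuclideanSpace ℝ (Fin d) → ℝ)
    (P : Fin n → EuclideanSpace ℝ (Fin d)) (𝒬 : Set (EuclideanSpace ℝ (Fin d)))
    (τ ε δ : ℝ) (time : ℝ → ℝ) (space : ℝ) : Prop where
  succeeds : ∀ x ∈ 𝒬, ∀ μ ∈ Set.Icc τ 1, kde k P x = μ →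
    upperExpectation ℙ (fun ω => (run A (image ω) x).toOuterMeasure
      {r | ε * μ ≤ |r.1 - μ| ∨ time μ < (r.2 : ℝ)}) ≤ ENNReal.ofReal δ
  time_le : ∀ x ∈ 𝒬, ∀ ω, ∀ r ∈ (run A (image ω) x).support, (r.2 : ℝ) ≤ time τ
  space_le : ∃ S : ℕ, (S : ℝ) ≤ space ∧ ∀ ω, StoredIn (image ω) S

end

/-! Every stored sample has its own independent hash function. Level `i` averages `N * 2 ^ i`
samples, truncated at a height proportional to `2 ^ (-i)`, and stops once the average reaches `4 ^
(-i)`; here `N` is of order `M ^ 3 * max 1 (log (1 / δ)) / ε ^ 2`. For scale exponent 1/2 the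
estimator is unbiased with second moment at most `M ^ 3 * μ ^ (3/2)` (`integral_hbeSqMean_le`).
Hence at the true level `I`, where `4 ^ I` is of order `1 / μ`, the `N * 2 ^ I` samples, of order `N
/ √μ`, give relative error `ε`. Level lengths double, so the last level dominates the cost.

Truncation takes the place of medians of means: the exponential of a truncated sample has a
quadratic majorant, so two moments suffice for a Chernoff bound, the truncation bias included
(`exists_chernoff_params`). Running through the levels costs no extra logarithm. To stop at level `I
- k` the average must reach at least `4 ^ k / 8` times `μ`, and the chance of a failure there is at
most `2 * exp (-3 * L * (k + 1))` with `L = max 1 (log (1 / δ))`; these bounds sum to at most `δ`.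
For `k ≤ 3` an early stop is likely enough, but the average is then already accurate.

Given the hash functions, the samples are independent, and the failure probability is at most a sum
of products with one factor per hash function (`failProb_levelScan_le`). The factors are measurable,
unlike perhaps the failure probability itself, and the products factorize under the product measure
(`lintegral_prod_range_infinitePi`). `run_scanProg_le_failProb` carries the bound from the abstract
scan to the machine. -/

noncomputable section

/-! ## Expectations of discrete laws -/

/-- The expectation of `f` under `p`. -/
def PMF.expect {α : Type*} (p : PMF α) (f : α → ℝ≥0∞) : ℝ≥0∞ := ∑' a, p a * f a

namespace PMF

variable {α β : Type*}

theorem expect_bind (p : PMF α) (q : α → PMF β) (f : β → ℝ≥0∞) :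
    (p.bind q).expect f = p.expect fun a => (q a).expect f := by
  simp only [expect, bind_apply, ← ENNReal.tsum_mul_left, ← ENNReal.tsum_mul_right, mul_assoc]
  exact ENNReal.tsum_comm

@[simp]
theorem expect_pure (a : α) (f : α → ℝ≥0∞) : (PMF.pure a).expect f = f a := by
  rw [expect, tsum_eq_single a]
  · simp
  · intro b hb
    simp [pure_apply, hb]

@[simp]
theorem expect_map (p : PMF α) (g : α → β) (f : β → ℝ≥0∞) :
    (p.map g).expect f = p.expect fun a => f (g a) := by
  rw [← bind_pure_comp, expect_bind]
  simp

theorem expect_mono_of_support {p : PMF α} {f g : α → ℝ≥0∞} (h : ∀ a ∈ p.support, f a ≤ g a) :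
    p.expect f ≤ p.expect g := by
  refine ENNReal.tsum_le_tsum fun a => ?_
  by_cases ha : p a = 0
  · simp [ha]
  · exact mul_le_mul_right (h a ((p.mem_support_iff a).2 ha)) _

theorem expect_mono {p : PMF α} {f g : α → ℝ≥0∞} (h : ∀ a, f a ≤ g a) :
    p.expect f ≤ p.expect g :=
  expect_mono_of_support fun a _ => h a

@[simp]
theorem expect_const (p : PMF α) (c : ℝ≥0∞) : p.expect (fun _ => c) = c := by
  simp [expect, ENNReal.tsum_mul_right, p.tsum_coe]

theorem expect_add (p : PMF α) (f g : α → ℝ≥0∞) :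
    p.expect (fun a => f a + g a) = p.expect f + p.expect g := by
  simp [expect, mul_add, ENNReal.tsum_add]

theorem expect_mul_const (p : PMF α) (f : α → ℝ≥0∞) (c : ℝ≥0∞) :
    p.expect (fun a => f a * c) = p.expect f * c := by
  simp [expect, ← mul_assoc, ENNReal.tsum_mul_right]

theorem expect_finset_sum {ι : Type*} (p : PMF α) (s : Finset ι) (f : ι → α → ℝ≥0∞) :
    p.expect (fun a => ∑ i ∈ s, f i a) = ∑ i ∈ s, p.expect (f i) := by
  induction s using Finset.induction_on with
  | empty => simp
  | insert a s ha ih => simp only [Finset.sum_insert ha, expect_add, ih]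

theorem toOuterMeasure_eq_expect (p : PMF α) (s : Set α) :
    p.toOuterMeasure s = p.expect (s.indicator 1) := by
  rw [toOuterMeasure_apply, expect]
  refine tsum_congr fun a => ?_
  by_cases h : a ∈ s <;> simp [h]

end PMF

/-! ## The query program -/

/-- The parameters of a scan of a sequence of samples. The samples, truncated at `trunc`, are summed
up, where `carry` resets the sum at the beginning of a group. At each sample the sum is multiplied
by `scale`, and the scan stops with this value if it is at least `thr`. -/
structure ScanParams where
  trunc : ℕ → ℝ
  carry : ℕ → ℝ
  scale : ℕ → ℝ
  thr : ℕ → ℝ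

namespace ScanParams

/-- The running sum after sample `j` took the value `z`. -/
def next (p : ScanParams) (j : ℕ) (S z : ℝ) : ℝ := p.carry j * S + min z (p.trunc j)

/-- The probability that a scan of the samples `j, …, j + m - 1`, with laws `q`, does not stop or
stops with a value in `bad`. -/
def failProb (p : ScanParams) (q : ℕ → PMF ℝ) (bad : Set ℝ) : ℕ → ℕ → ℝ → ℝ≥0∞
  | 0, _, _ => 1
  | m + 1, j, S => (q j).expect fun z =>
    if p.thr j ≤ p.scale j * p.next j S z then bad.indicator 1 (p.scale j * p.next j S z)
    else failProb p q bad m (j + 1) (p.next j S z)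

/-- The data `D` hold `J` blocks, made of the parameters and a table of size `W` for each sample. -/
structure StoredAs (p : ScanParams) (D : Cells) (J W : ℕ) (table : ℕ → Cells) : Prop where
  count : D 0 = J
  width : D 1 = W
  trunc : ∀ j < J, D (2 + j * (W + 4)) = p.trunc j
  carry : ∀ j < J, D (2 + j * (W + 4) + 1) = p.carry j
  scale : ∀ j < J, D (2 + j * (W + 4) + 2) = p.scale j
  thr : ∀ j < J, D (2 + j * (W + 4) + 3) = p.thr j
  table : ∀ j < J, slice D (2 + j * (W + 4) + 4) W = table j

end ScanParams

variable {𝓕 : Set (ℝ → ℝ → ℝ)}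

/-- Read the parameters of a block into the cells `5, 6, 7, 8`. -/
def readParams : Prog 𝓕 :=
  .seq (.load 5 3) <| .seq (.op .add 3 3 4) <| .seq (.load 6 3) <| .seq (.op .add 3 3 4) <|
  .seq (.load 7 3) <| .seq (.op .add 3 3 4) <| .seq (.load 8 3) <| .op .add 3 3 4

/-- Process the sample in cell `9`. -/
def processSample : Prog 𝓕 :=
  -- Cell 11 is never written, so adding it amounts to copying cell 5.
  .seq (.ite 9 5 .skip (.op .add 9 5 11)) <| .seq (.op .mul 10 6 10) <| .seq (.op .add 10 10 9) <|
  .seq (.op .mul 0 7 10) <| .seq (.op .add 3 3 2) <| .ite 8 0 (.const 4 0) .skip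

/-- The loop body of the query program: take a sample by means of `E` and process it. -/
def scanBody (E : Prog 𝓕) : Prog 𝓕 := .seq readParams <| .seq (.call 9 3 2 E) processSample

/-- The query program: scan the samples that `E` takes from the stored tables. -/
def scanProg (E : Prog 𝓕) : Prog 𝓕 :=
  -- Cell 3 is still blank and addresses data cell 0. The 1 in cell 4 is at once the address of the
  -- width, the increment of the data pointer and the loop flag.
  .seq (.load 1 3) <| .seq (.const 4 1) <| .seq (.load 2 4) <| .seq (.const 3 2) <|
  .loop 1 4 (scanBody E)

/-- The local cells before sample `j`, when the running sum is `S`. -/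
structure AtSample (W j : ℕ) (S : ℝ) (s : Cells) : Prop where
  width : s 2 = W
  pos : s 3 = (2 + j * (W + 4) : ℕ)
  flag : s 4 = 1
  sum : s 10 = S
  zero : s 11 = 0

/-! ### Symbolic execution of one pass of the loop. -/

theorem exec_seq_of_eq_pure {x : Cells} {p q : Prog 𝓕} {D s s' : Cells} {c : ℕ}
    (h : exec x p D s = PMF.pure (s', c)) :
    exec x (.seq p q) D s = (exec x q D s').map fun r => (r.1, c + r.2) := by
  simp [exec, h, PMF.pure_bind]

theorem exec_readParams {p : ScanParams} {D : Cells} {J W : ℕ} {table : ℕ → Cells}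
    (hD : p.StoredAs D J W table) {j : ℕ} (hj : j < J) {S : ℝ} {s : Cells}
    (hs : AtSample W j S s) (x : Cells) :
    ∃ s', exec x (readParams : Prog 𝓕) D s = PMF.pure (s', 8) ∧ s' 2 = W ∧
      s' 3 = (2 + j * (W + 4) + 4 : ℕ) ∧ s' 4 = 1 ∧ s' 5 = p.trunc j ∧ s' 6 = p.carry j ∧
      s' 7 = p.scale j ∧ s' 8 = p.thr j ∧ s' 10 = S ∧ s' 11 = 0 := by
  obtain ⟨h2, h3, h4, h10, h11⟩ := hs
  have e1 : (s 3 + 1) = ((2 + j * (W + 4) + 1 : ℕ) : ℝ) := by rw [h3]; push_cast; ring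
  have e2 : ((2 + j * (W + 4) + 1 : ℕ) : ℝ) + 1 = ((2 + j * (W + 4) + 2 : ℕ) : ℝ) := by
    push_cast; ring
  have e3 : ((2 + j * (W + 4) + 2 : ℕ) : ℝ) + 1 = ((2 + j * (W + 4) + 3 : ℕ) : ℝ) := by
    push_cast; ring
  have e4 : ((2 + j * (W + 4) + 3 : ℕ) : ℝ) + 1 = ((2 + j * (W + 4) + 4 : ℕ) : ℝ) := by
    push_cast; ring
  refine ⟨_, by simp only [readParams, exec, PMF.pure_bind, PMF.pure_map]; rfl, ?_⟩
  simp only [Op.apply, Function.update_apply]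
  norm_num only [h2, h4, h10, h11, if_true, if_false]
  simp only [e1, e2, e3, e4, Nat.floor_natCast]
  rw [h3, Nat.floor_natCast]
  exact ⟨trivial, trivial, trivial, hD.trunc j hj, hD.carry j hj, hD.scale j hj, hD.thr j hj, trivial, trivial⟩

/-- Both branches of each test cost the same, so the step count does not depend on the sample. -/
theorem exec_processSample (p : ScanParams) {W j : ℕ} {S z : ℝ} {s D : Cells}
    (h2 : s 2 = W) (h3 : s 3 = (2 + j * (W + 4) + 4 : ℕ)) (h4 : s 4 = 1) (h5 : s 5 = p.trunc j)
    (h6 : s 6 = p.carry j) (h7 : s 7 = p.scale j) (h8 : s 8 = p.thr j) (h9 : s 9 = z)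
    (h10 : s 10 = S) (h11 : s 11 = 0) (x : Cells) :
    ∃ s', exec x (processSample : Prog 𝓕) D s = PMF.pure (s', 8) ∧
      s' 0 = p.scale j * p.next j S z ∧
      (p.thr j ≤ p.scale j * p.next j S z → s' 4 = 0) ∧
      (¬ p.thr j ≤ p.scale j * p.next j S z → AtSample W (j + 1) (p.next j S z) s') := by
  obtain ⟨s1, e1, k2, k3, k4, k6, k7, k8, k9, k10, k11⟩ : ∃ s1,
      exec x (.ite 9 5 .skip (.op .add 9 5 11) : Prog 𝓕) D s = PMF.pure (s1, 2) ∧ s1 2 = s 2 ∧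
      s1 3 = s 3 ∧ s1 4 = s 4 ∧ s1 6 = s 6 ∧ s1 7 = s 7 ∧ s1 8 = s 8 ∧
      s1 9 = min z (p.trunc j) ∧ s1 10 = s 10 ∧ s1 11 = s 11 := by
    by_cases h : z ≤ p.trunc j
    · exact ⟨s, by simp [exec, h9, h5, h, PMF.pure_map], rfl, rfl, rfl, rfl, rfl, rfl, by simp [h, h9],
        rfl, rfl⟩
    · refine ⟨_, by simp only [exec, h9, h5, h, if_false, PMF.pure_map]; rfl, ?_⟩
      simp [Op.apply, h11, (not_le.1 h).le]
  have e : (p.next j S z) = s1 6 * s1 10 + s1 9 := by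
    rw [k6, k9, k10, h6, h10]; rfl
  obtain ⟨s2, f1, l0, l2, l3, l4, l8, l10, l11⟩ : ∃ s2,
      exec x (.seq (.op .mul 10 6 10) <| .seq (.op .add 10 10 9) <|
        .seq (.op .mul 0 7 10) <| (.op .add 3 3 2) : Prog 𝓕) D s1 = PMF.pure (s2, 4) ∧
      s2 0 = p.scale j * p.next j S z ∧ s2 2 = W ∧ s2 3 = (2 + (j + 1) * (W + 4) : ℕ) ∧
      s2 4 = 1 ∧ s2 8 = p.thr j ∧ s2 10 = p.next j S z ∧ s2 11 = 0 := by
    refine ⟨_, by simp only [exec, PMF.pure_bind, PMF.pure_map]; rfl, ?_⟩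
    rw [e]
    simp only [Op.apply, Function.update_apply]
    norm_num only [if_true, if_false]
    simp only [k2, k3, k4, k7, k8, k11, h2, h3, h4, h7, h8, h11]
    refine ⟨trivial, trivial, ?_, trivial, trivial, trivial, trivial⟩
    push_cast; ring
  have f2 : exec x (processSample : Prog 𝓕) D s =
      (exec x (.ite 8 0 (.const 4 0) .skip : Prog 𝓕) D s2).map fun r => (r.1, 6 + r.2) := by
    simp only [exec, PMF.pure_bind, PMF.pure_map] at f1 
    -- Equality of two point masses yields equality of the final memories through their supports.
    have f3 := congrArg PMF.support f1
    simp only [PMF.support_pure, Set.singleton_eq_singleton_iff, Prod.mk.injEq] at f3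
    replace f3 := f3.1
    rw [processSample, exec_seq_of_eq_pure e1]
    simp only [exec, PMF.pure_bind, PMF.map_comp, f3]
    congr 1
    funext r
    simp only [Function.comp, Prod.mk.injEq, true_and]
    omega
  rw [f2]
  by_cases h : p.thr j ≤ p.scale j * p.next j S z
  · refine ⟨Function.update s2 4 0, by simp [exec, l0, l8, h, PMF.pure_map], ?_, ?_, ?_⟩
    · simp [l0]
    · simp
    · simp [h]
  · refine ⟨s2, by simp [exec, l0, l8, h, PMF.pure_map], l0, by simp [h], fun _ => ?_⟩
    exact ⟨l2, l3, l4, l10, l11⟩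

/-- The only randomness of a pass is in the call, which starts from blank cells and sees only its
own table. The new memory is therefore a function of the sample alone. The overhead is 8 + 1 + 8
steps. -/
theorem exec_scanBody (E : Prog 𝓕) {p : ScanParams} {D : Cells} {J W : ℕ} {table : ℕ → Cells}
    (hD : p.StoredAs D J W table) {j : ℕ} (hj : j < J) {S : ℝ} {s : Cells}
    (hs : AtSample W j S s) (x : Cells) :
    ∃ s' : ℝ → Cells, exec x (scanBody E) D s =
        (exec x E (table j) 0).map (fun r => (s' (r.1 0), r.2 + 17)) ∧ ∀ z,
      s' z 0 = p.scale j * p.next j S z ∧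
      (p.thr j ≤ p.scale j * p.next j S z → s' z 4 = 0) ∧
      (¬ p.thr j ≤ p.scale j * p.next j S z → AtSample W (j + 1) (p.next j S z) (s' z)) := by
  obtain ⟨s1, e1, h2, h3, h4, h5, h6, h7, h8, h10, h11⟩ := exec_readParams (𝓕 := 𝓕) hD hj hs x
  have key : ∀ z, ∃ s', exec x (processSample : Prog 𝓕) D (Function.update s1 9 z) =
        PMF.pure (s', 8) ∧
      s' 0 = p.scale j * p.next j S z ∧
      (p.thr j ≤ p.scale j * p.next j S z → s' 4 = 0) ∧
      (¬ p.thr j ≤ p.scale j * p.next j S z → AtSample W (j + 1) (p.next j S z) s') := by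
    intro z
    apply exec_processSample <;> simp [h2, h4, h5, h6, h7, h8, h10, h11]
    rw [h3]; push_cast; ring
  choose s' e2 hs' using key
  refine ⟨s', ?_, hs'⟩
  have e3 : exec x (.call 9 3 2 E) D s1 =
      (exec x E (table j) 0).map fun r => (Function.update s1 9 (r.1 0), 1 + r.2) := by
    rw [exec, h3, h2, Nat.floor_natCast, Nat.floor_natCast, hD.table j hj]
  rw [scanBody, exec_seq_of_eq_pure e1, exec, e3, PMF.bind_map, PMF.map_bind]
  simp only [Function.comp_def, e2, PMF.pure_map]
  rw [PMF.map]
  congr 1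
  funext r
  simp only [Function.comp_def]
  congr 2
  omega

/-! ### From the machine to the abstract scan. -/

theorem execLoop_succ_of_ne_zero {body : Cells → PMF (Cells × ℕ)} {b m : ℕ} {s : Cells}
    (h : s b ≠ 0) : execLoop body b (m + 1) s = (body s).bind fun r =>
      (execLoop body b m r.1).map fun r' => (r'.1, 1 + r.2 + r'.2) := by
  simp [execLoop, h]

theorem execLoop_of_eq_zero {body : Cells → PMF (Cells × ℕ)} {b : ℕ} (m : ℕ) {s : Cells}
    (h : s b = 0) : execLoop body b m s = PMF.pure (s, 1) := by
  cases m <;> simp [execLoop, h]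

theorem PMF.expect_indicator_le_one {α : Type*} (p : PMF α) (s : Set α) :
    p.expect (s.indicator 1) ≤ 1 := by
  refine (PMF.expect_mono (g := fun _ => 1) fun a => ?_).trans (p.expect_const 1).le
  exact Set.indicator_le_self _ _ a

theorem indicator_one_le_indicator_one {α β : Type*} {s : Set α} {t : Set β} {a : α} {b : β}
    (h : a ∈ s → b ∈ t) : s.indicator (1 : α → ℝ≥0∞) a ≤ t.indicator 1 b := by
  by_cases ha : a ∈ s
  · simp [ha, h ha]
  · simp [ha]

/-- A run that stops within `k` samples takes at most `k` passes of `T + 17` steps, a test before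
each, and a last test. Overtime thus means that the scan has not stopped, which `failProb` counts as
failure once its budget `k` is used up. -/
theorem expect_execLoop_scanBody_le (E : Prog 𝓕) {p : ScanParams} {D : Cells} {J W T : ℕ}
    {table : ℕ → Cells} (hD : p.StoredAs D J W table) {x : Cells} {q : ℕ → PMF ℝ}
    (hq : ∀ j < J, (exec x E (table j) 0).map (fun r => r.1 0) = q j)
    (hT : ∀ j < J, ∀ r ∈ (exec x E (table j) 0).support, r.2 ≤ T) (bad : Set ℝ)
    {k m j : ℕ} (hm : m + j = J) (hk : k ≤ m) {S : ℝ} {s : Cells} (hs : AtSample W j S s) :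
    (execLoop (fun s' => exec x (scanBody E) D s') 4 m s).expect
      ({r | r.1 0 ∈ bad ∨ k * (T + 18) + 1 < r.2}.indicator 1) ≤ p.failProb q bad k j S := by
  induction k generalizing m j S s with
  | zero => exact PMF.expect_indicator_le_one _ _
  | succ k ih =>
    obtain ⟨m, rfl⟩ : ∃ m', m = m' + 1 := ⟨m - 1, by omega⟩
    have hj : j < J := by omega
    obtain ⟨s', he, hs'⟩ := exec_scanBody E hD hj hs x
    rw [execLoop_succ_of_ne_zero (by rw [hs.flag]; exact one_ne_zero), PMF.expect_bind, he,
      PMF.expect_map, ScanParams.failProb, ← hq j hj, PMF.expect_map]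
    -- The bound `T` on the running time of `E` is available on the support only.
    refine PMF.expect_mono_of_support fun r hr => ?_
    have hrT := hT j hj r hr
    obtain ⟨h0, h1, h2⟩ := hs' (r.1 0)
    rw [PMF.expect_map]
    split_ifs with h
    · rw [execLoop_of_eq_zero _ (h1 h), PMF.expect_pure]
      simp only [Set.indicator_apply, Set.mem_ofPred_eq, h0]
      have : ¬ ((k + 1) * (T + 18) + 1 < 1 + (r.2 + 17) + 1) := by
        have : T + 18 ≤ (k + 1) * (T + 18) := Nat.le_mul_of_pos_left _ (by omega)
        omega
      simp [this]
    · refine le_trans (PMF.expect_mono fun r' => ?_) (ih (by omega) (by omega) (h2 h))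
      refine indicator_one_le_indicator_one (Or.imp_right fun h => ?_)
      simp only at h
      have : (k + 1) * (T + 18) = k * (T + 18) + T + 18 := by ring
      omega

theorem le_of_mem_support_execLoop_scanBody (E : Prog 𝓕) {p : ScanParams} {D : Cells} {J W T : ℕ}
    {table : ℕ → Cells} (hD : p.StoredAs D J W table) {x : Cells}
    (hT : ∀ j < J, ∀ r ∈ (exec x E (table j) 0).support, r.2 ≤ T)
    {m j : ℕ} (hm : m + j = J) {S : ℝ} {s : Cells} (hs : AtSample W j S s) :
    ∀ r ∈ (execLoop (fun s' => exec x (scanBody E) D s') 4 m s).support,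
      r.2 ≤ m * (T + 18) + 1 := by
  induction m generalizing j S s with
  | zero => intro r hr; simp_all [execLoop]
  | succ m ih =>
    have hj : j < J := by omega
    obtain ⟨s', he, hs'⟩ := exec_scanBody E hD hj hs x
    rw [execLoop_succ_of_ne_zero (by rw [hs.flag]; exact one_ne_zero), he]
    intro r hr
    simp only [PMF.mem_support_bind_iff, PMF.mem_support_map_iff] at hr
    obtain ⟨_, ⟨a, ha, rfl⟩, r', hr', rfl⟩ := hr
    have haT := hT j hj a ha
    obtain ⟨h0, h1, h2⟩ := hs' (a.1 0)
    have e : (m + 1) * (T + 18) = m * (T + 18) + T + 18 := by ring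
    have : r'.2 ≤ m * (T + 18) + 1 := by
      by_cases h : p.thr j ≤ p.scale j * p.next j S (a.1 0)
      · rw [execLoop_of_eq_zero _ (h1 h)] at hr'
        simp_all
      · exact ih (by omega) (h2 h) r' hr'
    simp only
    omega

theorem exec_scanProg (E : Prog 𝓕) {p : ScanParams} {D : Cells} {J W : ℕ}
    {table : ℕ → Cells} (hD : p.StoredAs D J W table) (x : Cells) :
    ∃ s, AtSample W 0 0 s ∧ exec x (scanProg E) D 0 =
      (execLoop (fun s' => exec x (scanBody E) D s') 4 J s).map fun r => (r.1, 4 + r.2) := by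
  refine ⟨Function.update (Function.update (Function.update (Function.update (0 : Cells) 1 (J : ℝ))
    4 1) 2 (W : ℝ)) 3 2, ⟨by simp, by simp, by simp, by simp, by simp⟩, ?_⟩
  have h1 : exec x (.load 1 3 : Prog 𝓕) D 0 = PMF.pure (Function.update (0 : Cells) 1 (J : ℝ), 1) := by
    simp [exec, hD.count]
  have h2 : exec x (.load 2 4 : Prog 𝓕) D (Function.update (Function.update (0 : Cells) 1 (J : ℝ)) 4 1) =
      PMF.pure (Function.update (Function.update (Function.update (0 : Cells) 1 (J : ℝ)) 4 1) 2 (W : ℝ), 1) := by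
    simp [exec, hD.width]
  rw [scanProg, exec_seq_of_eq_pure h1, exec_seq_of_eq_pure (by rw [exec, Nat.cast_one]),
    exec_seq_of_eq_pure h2, exec_seq_of_eq_pure (by rw [exec, Nat.cast_ofNat]), exec]
  simp only [PMF.map_comp]
  simp only [Function.update_apply]
  norm_num only [if_true, if_false, Nat.floor_natCast]
  congr 1
  funext r
  simp only [Function.comp, Prod.mk.injEq, true_and]
  omega

theorem run_scanProg_le_failProb {d : ℕ} (E : Prog 𝓕) {p : ScanParams} {D : Cells} {J W T : ℕ}
    {table : ℕ → Cells} (hD : p.StoredAs D J W table) {x : EuclideanSpace ℝ (Fin d)}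
    {q : ℕ → PMF ℝ} (hq : ∀ j < J, (run E (table j) x).map Prod.fst = q j)
    (hT : ∀ j < J, ∀ r ∈ (run E (table j) x).support, r.2 ≤ T) (bad : Set ℝ)
    {k : ℕ} (hk : k ≤ J) :
    (run (scanProg E) D x).toOuterMeasure {r | r.1 ∈ bad ∨ k * (T + 18) + 5 < r.2} ≤
      p.failProb q bad k 0 0 := by
  obtain ⟨s, hs, he⟩ := exec_scanProg E hD (coords x)
  rw [PMF.toOuterMeasure_eq_expect, run, he, PMF.map_comp, PMF.expect_map]
  refine le_trans (PMF.expect_mono fun r => ?_) (expect_execLoop_scanBody_le E hD (q := q) (T := T)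
    (fun j hj => ?_) (fun j hj r hr => ?_) bad (add_zero J) hk hs)
  · refine indicator_one_le_indicator_one (Or.imp_right fun h => ?_)
    simp only [Function.comp] at h
    omega
  · rw [← hq j hj, run, PMF.map_comp]
    rfl
  · refine hT j hj (r.1 0, r.2) ?_
    rw [run, PMF.mem_support_map_iff]
    exact ⟨r, hr, rfl⟩

theorem le_of_mem_support_run_scanProg {d : ℕ} (E : Prog 𝓕) {p : ScanParams} {D : Cells}
    {J W T : ℕ} {table : ℕ → Cells} (hD : p.StoredAs D J W table) {x : EuclideanSpace ℝ (Fin d)}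
    (hT : ∀ j < J, ∀ r ∈ (run E (table j) x).support, r.2 ≤ T) :
    ∀ r ∈ (run (scanProg E) D x).support, r.2 ≤ J * (T + 18) + 5 := by
  obtain ⟨s, hs, he⟩ := exec_scanProg E hD (coords x)
  intro r hr
  rw [run, he, PMF.map_comp, PMF.mem_support_map_iff] at hr
  obtain ⟨a, ha, rfl⟩ := hr
  have := le_of_mem_support_execLoop_scanBody E hD (T := T) (fun j hj r hr =>
    hT j hj (r.1 0, r.2) (by rw [run, PMF.mem_support_map_iff]; exact ⟨r, hr, rfl⟩))
    (add_zero J) hs a ha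
  simp only [Function.comp]
  omega

/-! ### Memory layout. -/

/-- The image of a stored sequence of samples. -/
def scanImage (p : ScanParams) (J W : ℕ) (table : ℕ → Cells) : Cells := fun a =>
  if a = 0 then J else if a = 1 then W else
    if (a - 2) / (W + 4) < J then
      if (a - 2) % (W + 4) = 0 then p.trunc ((a - 2) / (W + 4))
      else if (a - 2) % (W + 4) = 1 then p.carry ((a - 2) / (W + 4))
      else if (a - 2) % (W + 4) = 2 then p.scale ((a - 2) / (W + 4))
      else if (a - 2) % (W + 4) = 3 then p.thr ((a - 2) / (W + 4))
      else table ((a - 2) / (W + 4)) ((a - 2) % (W + 4) - 4)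
    else 0

theorem scanImage_apply (p : ScanParams) {J W : ℕ} (table : ℕ → Cells) {j o : ℕ} (hj : j < J)
    (ho : o < W + 4) : scanImage p J W table (2 + j * (W + 4) + o) =
      if o = 0 then p.trunc j else if o = 1 then p.carry j else if o = 2 then p.scale j
      else if o = 3 then p.thr j else table j (o - 4) := by
  have e : 2 + j * (W + 4) + o - 2 = o + (W + 4) * j := by
    rw [mul_comm]; omega
  have e1 : (2 + j * (W + 4) + o - 2) / (W + 4) = j := by
    rw [e, Nat.add_mul_div_left _ _ (by omega), Nat.div_eq_of_lt ho, zero_add]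
  have e2 : (2 + j * (W + 4) + o - 2) % (W + 4) = o := by
    rw [e, Nat.add_mul_mod_self_left, Nat.mod_eq_of_lt ho]
  rw [scanImage, e1, e2, if_neg (by omega), if_neg (by omega), if_pos hj]

theorem storedAs_scanImage (p : ScanParams) (J W : ℕ) {table : ℕ → Cells}
    (h : ∀ j, StoredIn (table j) W) : p.StoredAs (scanImage p J W table) J W table where
  count := by simp [scanImage]
  width := by simp [scanImage]
  trunc j hj := by simpa using scanImage_apply p table hj (o := 0) (by omega)
  carry j hj := by simpa using scanImage_apply p table hj (o := 1) (by omega)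
  scale j hj := by simpa using scanImage_apply p table hj (o := 2) (by omega)
  thr j hj := by simpa using scanImage_apply p table hj (o := 3) (by omega)
  table j hj := by
    funext i
    rw [slice]
    split_ifs with hi
    · rw [add_assoc (2 + j * (W + 4)), scanImage_apply p table hj (o := 4 + i) (by omega)]
      simp only [show 4 + i ≠ 0 by omega, show 4 + i ≠ 1 by omega, show 4 + i ≠ 2 by omega,
        show 4 + i ≠ 3 by omega, if_false, Nat.add_sub_cancel_left]
    · exact (h j i (by omega)).symm

theorem storedIn_scanImage (p : ScanParams) (J W : ℕ) (table : ℕ → Cells) :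
    StoredIn (scanImage p J W table) (2 + J * (W + 4)) := by
  intro a ha
  have : ¬ (a - 2) / (W + 4) < J := by
    rw [not_lt, Nat.le_div_iff_mul_le (by omega)]
    omega
  rw [scanImage, if_neg (by omega), if_neg, if_neg this]
  rintro rfl
  omega

end

noncomputable section

/-! ## Moments of hashing-based estimators -/

section Moments

variable {d n : ℕ} {H : Type u} [MeasurableSpace H] {B : Type v}

/-- The conditional mean, given `h`, of the hashing-based estimator. -/
def hbeMean (k : EuclideanSpace ℝ (Fin d) → EuclideanSpace ℝ (Fin d) → ℝ) (ν : Measure H)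
    (hash : H → EuclideanSpace ℝ (Fin d) → B) (P : Fin n → EuclideanSpace ℝ (Fin d))
    (x : EuclideanSpace ℝ (Fin d)) (h : H) : ℝ :=
  ∑ i ∈ bucket hash P h x, 1 / (n : ℝ) * (k x (P i) / collisionProb ν hash x (P i))

/-- The conditional second moment, given `h`, of the hashing-based estimator. -/
def hbeSqMean (k : EuclideanSpace ℝ (Fin d) → EuclideanSpace ℝ (Fin d) → ℝ) (ν : Measure H)
    (hash : H → EuclideanSpace ℝ (Fin d) → B) (P : Fin n → EuclideanSpace ℝ (Fin d))
    (x : EuclideanSpace ℝ (Fin d)) (h : H) : ℝ :=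
  ∑ i ∈ bucket hash P h x, ∑ _j ∈ bucket hash P h x,
    (1 / (n : ℝ) * (k x (P i) / collisionProb ν hash x (P i))) ^ 2

variable {k : EuclideanSpace ℝ (Fin d) → EuclideanSpace ℝ (Fin d) → ℝ} {ν : Measure H}
  {hash : H → EuclideanSpace ℝ (Fin d) → B} {P : Fin n → EuclideanSpace ℝ (Fin d)}
  {x : EuclideanSpace ℝ (Fin d)}

theorem PMF.expect_uniformOfFinset {α : Type*} {s : Finset α} (hs : s.Nonempty)
    (f : α → ℝ≥0∞) :
    (PMF.uniformOfFinset s hs).expect f = ∑ i ∈ s, (s.card : ℝ≥0∞)⁻¹ * f i := by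
  rw [expect, tsum_eq_sum (s := s)]
  · exact Finset.sum_congr rfl fun i hi => by rw [uniformOfFinset_apply_of_mem hs hi]
  · intro i hi
    rw [uniformOfFinset_apply_of_notMem hs hi, zero_mul]

/-- An upper bound on the conditional expectation of a function of the hashing-based estimator that
has a quadratic majorant. -/
theorem expect_hbeLaw_le (hk : ∀ x y, 0 ≤ k x y) (h : H) {f : ℝ → ℝ} {a b : ℝ}
    (hf0 : ∀ z, 0 ≤ f z) (hf : ∀ z, 0 ≤ z → f z ≤ 1 + a * z + b * z ^ 2) :
    (hbeLaw k ν hash P h x).expect (fun z => ENNReal.ofReal (f z)) ≤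
      ENNReal.ofReal (1 + a * hbeMean k ν hash P x h + b * hbeSqMean k ν hash P x h) := by
  rw [hbeLaw]
  split_ifs with hne
  · rw [PMF.expect_map, PMF.expect_uniformOfFinset]
    have hc : 0 < ((bucket hash P h x).card : ℝ) := by exact_mod_cast hne.card_pos
    set c : ℝ := ((bucket hash P h x).card : ℝ) with hcdef
    have e : ((bucket hash P h x).card : ℝ≥0∞)⁻¹ = ENNReal.ofReal c⁻¹ := by
      rw [ENNReal.ofReal_inv_of_pos hc, hcdef, ENNReal.ofReal_natCast]
    simp only [e, ← ENNReal.ofReal_mul (inv_nonneg.2 hc.le)]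
    rw [← ENNReal.ofReal_sum_of_nonneg fun i _ => mul_nonneg (inv_nonneg.2 hc.le) (hf0 _)]
    refine ENNReal.ofReal_le_ofReal ?_
    calc _ ≤ ∑ i ∈ bucket hash P h x, c⁻¹ * (1 +
            a * (1 / (n : ℝ) * (k x (P i) / collisionProb ν hash x (P i)) * c) +
            b * (1 / (n : ℝ) * (k x (P i) / collisionProb ν hash x (P i)) * c) ^ 2) := by
          refine Finset.sum_le_sum fun i _ => mul_le_mul_of_nonneg_left (hf _ ?_)
            (inv_nonneg.2 hc.le)
          have : 0 ≤ collisionProb ν hash x (P i) := measureReal_nonneg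
          have := hk x (P i)
          positivity
      _ = ∑ i ∈ bucket hash P h x, (c⁻¹ +
            a * (1 / (n : ℝ) * (k x (P i) / collisionProb ν hash x (P i))) +
            b * (c * (1 / (n : ℝ) * (k x (P i) / collisionProb ν hash x (P i))) ^ 2)) := by
          refine Finset.sum_congr rfl fun i _ => ?_
          field_simp
      _ = _ := by
          simp only [Finset.sum_add_distrib, ← Finset.mul_sum, hbeMean, hbeSqMean,
            Finset.sum_const, nsmul_eq_mul, ← hcdef, mul_inv_cancel₀ hc.ne']
  -- For an empty cell the estimator is 0, and the majorant at 0 is 1.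
  · rw [Finset.not_nonempty_iff_eq_empty] at hne
    simp only [PMF.expect_pure, hbeMean, hbeSqMean, hne, Finset.sum_empty]
    exact ENNReal.ofReal_le_ofReal (by simpa using hf 0 le_rfl)

theorem hbeMean_eq_sum_indicator (h : H) : hbeMean k ν hash P x h =
    ∑ i, {h | hash h (P i) = hash h x}.indicator
      (fun _ => 1 / (n : ℝ) * (k x (P i) / collisionProb ν hash x (P i))) h := by
  simp only [hbeMean, bucket, Finset.sum_filter, Set.indicator_apply, Set.mem_ofPred_eq]

theorem hbeSqMean_eq_sum_indicator (h : H) : hbeSqMean k ν hash P x h =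
    ∑ i, ∑ j, ({h | hash h (P i) = hash h x} ∩ {h | hash h (P j) = hash h x}).indicator
      (fun _ => (1 / (n : ℝ) * (k x (P i) / collisionProb ν hash x (P i))) ^ 2) h := by
  simp only [hbeSqMean, bucket, Finset.sum_filter, Set.indicator_apply, Set.mem_inter_iff,
    Set.mem_ofPred_eq]
  refine Finset.sum_congr rfl fun i _ => ?_
  split_ifs with hi <;> simp [hi]

theorem measurable_hbeMean (hm : ∀ i, MeasurableSet {h | hash h (P i) = hash h x}) :
    Measurable (hbeMean k ν hash P x) := by
  simp only [funext (hbeMean_eq_sum_indicator (k := k) (ν := ν) (hash := hash) (P := P) (x := x))]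
  exact Finset.measurable_sum _ fun i _ => measurable_const.indicator (hm i)

theorem measurable_hbeSqMean (hm : ∀ i, MeasurableSet {h | hash h (P i) = hash h x}) :
    Measurable (hbeSqMean k ν hash P x) := by
  simp only [funext (hbeSqMean_eq_sum_indicator (k := k) (ν := ν) (hash := hash) (P := P) (x := x))]
  exact Finset.measurable_sum _ fun i _ => Finset.measurable_sum _ fun j _ =>
    measurable_const.indicator ((hm i).inter (hm j))

variable [IsProbabilityMeasure ν]

theorem integrable_hbeMean (hm : ∀ i, MeasurableSet {h | hash h (P i) = hash h x}) :
    Integrable (hbeMean k ν hash P x) ν := by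
  simp only [funext (hbeMean_eq_sum_indicator (k := k) (ν := ν) (hash := hash) (P := P) (x := x))]
  exact integrable_finsetSum _ fun i _ => (integrable_const _).indicator (hm i)

theorem integrable_hbeSqMean (hm : ∀ i, MeasurableSet {h | hash h (P i) = hash h x}) :
    Integrable (hbeSqMean k ν hash P x) ν := by
  simp only [funext (hbeSqMean_eq_sum_indicator (k := k) (ν := ν) (hash := hash) (P := P) (x := x))]
  exact integrable_finsetSum _ fun i _ => integrable_finsetSum _ fun j _ =>
    (integrable_const _).indicator ((hm i).inter (hm j))

/-- The hashing-based estimator is unbiased. -/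
theorem integral_hbeMean (hm : ∀ i, MeasurableSet {h | hash h (P i) = hash h x})
    (hpos : ∀ i, collisionProb ν hash x (P i) = 0 → k x (P i) = 0) :
    ∫ h, hbeMean k ν hash P x h ∂ν = kde k P x := by
  simp only [hbeMean_eq_sum_indicator]
  rw [integral_finsetSum _ fun i _ => (integrable_const _).indicator (hm i), kde, Finset.mul_sum]
  refine Finset.sum_congr rfl fun i _ => ?_
  rw [integral_indicator_const _ (hm i)]
  change collisionProb ν hash x (P i) • _ = _
  by_cases h : collisionProb ν hash x (P i) = 0
  · simp [h, hpos i h]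
  · rw [smul_eq_mul]
    field_simp

/-- The exponent 1/2 balances two factors. With `w` the kernel and `p` the collision probability,
the lower bound on `p` gives `(w / p) ^ 2 ≤ M ^ 2 * w`, which averages to the density. The upper
bound makes the expected cell size at most `n * M` times the average of `√w`, which by
Cauchy–Schwarz is at most the root of the density. -/
theorem integral_hbeSqMean_le (hm : ∀ i, MeasurableSet {h | hash h (P i) = hash h x})
    (hk : ∀ x y, 0 ≤ k x y) {M : ℝ} (hM : 0 < M)
    (hlow : ∀ i, M⁻¹ * √(k x (P i)) ≤ collisionProb ν hash x (P i))
    (hup : ∀ i, collisionProb ν hash x (P i) ≤ M * √(k x (P i))) :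
    ∫ h, hbeSqMean k ν hash P x h ∂ν ≤ M ^ 3 * kde k P x * √(kde k P x) := by
  have hn : (0 : ℝ) ≤ 1 / n := by positivity
  have hv : ∀ i, (k x (P i) / collisionProb ν hash x (P i)) ^ 2 ≤ M ^ 2 * k x (P i) := by
    intro i
    have h0 : 0 ≤ collisionProb ν hash x (P i) := measureReal_nonneg
    have h1 : k x (P i) / collisionProb ν hash x (P i) ≤ M * √(k x (P i)) := by
      refine div_le_of_le_mul₀ h0 (by positivity) ?_
      have := mul_le_mul_of_nonneg_left (hlow i) (a := M * √(k x (P i))) (by positivity)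
      rwa [show M * √(k x (P i)) * (M⁻¹ * √(k x (P i))) = √(k x (P i)) * √(k x (P i)) by
        field_simp, Real.mul_self_sqrt (hk _ _)] at this
    calc _ ≤ (M * √(k x (P i))) ^ 2 := by
          gcongr
          exact div_nonneg (hk _ _) h0
      _ = _ := by rw [mul_pow, Real.sq_sqrt (hk _ _)]
  have hsum : 1 / (n : ℝ) * ∑ j, √(k x (P j)) ≤ √(kde k P x) := by
    refine Real.le_sqrt_of_sq_le ?_
    have h1 := sq_sum_le_card_mul_sum_sq (s := Finset.univ) (f := fun j => √(k x (P j)))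
    simp only [Real.sq_sqrt (hk _ _), Finset.card_univ, Fintype.card_fin] at h1
    rw [mul_pow, kde]
    calc _ ≤ (1 / (n : ℝ)) ^ 2 * (n * ∑ i, k x (P i)) := by gcongr
      _ = (1 / (n : ℝ)) * (1 / (n : ℝ) * n) * ∑ i, k x (P i) := by ring
      _ ≤ (1 / (n : ℝ)) * 1 * ∑ i, k x (P i) := by
          have : 0 ≤ ∑ i, k x (P i) := Finset.sum_nonneg fun i _ => hk _ _
          have : 1 / (n : ℝ) * n ≤ 1 := by
            rw [one_div]
            exact inv_mul_le_one
          gcongr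
      _ = _ := by ring
  simp only [hbeSqMean_eq_sum_indicator]
  rw [integral_finsetSum _ fun i _ => integrable_finsetSum _ fun j _ =>
    (integrable_const _).indicator ((hm i).inter (hm j))]
  calc _ ≤ ∑ i, ∑ j, (1 / (n : ℝ) * (1 / (n : ℝ)) *
          (M ^ 2 * k x (P i)) * (M * √(k x (P j)))) := by
        refine Finset.sum_le_sum fun i _ => ?_
        rw [integral_finsetSum _ fun j _ => (integrable_const _).indicator ((hm i).inter (hm j))]
        refine Finset.sum_le_sum fun j _ => ?_
        rw [integral_indicator_const _ ((hm i).inter (hm j)), smul_eq_mul, mul_pow, mul_comm]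
        -- The joint collision probability of two data points is bounded by that of the second
        -- alone, so nothing is needed about the dependence of collisions.
        refine mul_le_mul ?_ ((measureReal_mono Set.inter_subset_right).trans (hup j))
          measureReal_nonneg ?_
        · rw [← sq]
          gcongr
          exact hv i
        · have := hk x (P i)
          positivity
    _ = M ^ 3 * kde k P x * (1 / (n : ℝ) * ∑ j, √(k x (P j))) := by
        simp only [← Finset.mul_sum, ← Finset.sum_mul, kde]
        ring
    _ ≤ _ := by
        have : 0 ≤ kde k P x := mul_nonneg hn (Finset.sum_nonneg fun i _ => hk _ _)
        gcongr

/-- Averages the conditional majorant over the hash function and applies `1 + y ≤ exp y`; this is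
one factor of the Chernoff product. -/
theorem lintegral_quadratic_hbe_le (hm : ∀ i, MeasurableSet {h | hash h (P i) = hash h x})
    {a b V : ℝ} (hb : 0 ≤ b) (hmean : ∫ h, hbeMean k ν hash P x h ∂ν = kde k P x)
    (hV : ∫ h, hbeSqMean k ν hash P x h ∂ν ≤ V) (hnn : ∀ h, 0 ≤ 1 + a * hbeMean k ν hash P x h +
      b * hbeSqMean k ν hash P x h) :
    ∫⁻ h, ENNReal.ofReal (1 + a * hbeMean k ν hash P x h + b * hbeSqMean k ν hash P x h) ∂ν ≤
      ENNReal.ofReal (Real.exp (a * kde k P x + b * V)) := by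
  have i1 := (integrable_hbeMean (k := k) (ν := ν) hm).const_mul a
  have i2 := (integrable_hbeSqMean (k := k) (ν := ν) hm).const_mul b
  have i0 : Integrable (fun h => 1 + a * hbeMean k ν hash P x h) ν := (integrable_const 1).add i1
  have i3 : Integrable (fun h => 1 + a * hbeMean k ν hash P x h + b * hbeSqMean k ν hash P x h) ν :=
    i0.add i2
  rw [← ofReal_integral_eq_lintegral_ofReal i3 (ae_of_all _ hnn)]
  refine ENNReal.ofReal_le_ofReal ?_
  rw [integral_add i0 i2, integral_add (integrable_const 1) i1, integral_const_mul,
    integral_const_mul, hmean]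
  simp only [integral_const, probReal_univ, smul_eq_mul, mul_one]
  have h1 := Real.add_one_le_exp (a * kde k P x + b * V)
  have h2 := mul_le_mul_of_nonneg_left hV hb
  linarith

end Moments

end

noncomputable section

/-! ## Exponential moments of truncated samples -/

/-- On `[0, u]` the convex function `exp` lies below its chord. No second moment enters, so `u` may
be large; this serves the levels far before the true one. -/
theorem exp_mul_min_le_linear {z t u : ℝ} (hz : 0 ≤ z) (ht : 0 < t) (hu : 0 ≤ u) :
    Real.exp (u / t * min z t) ≤ 1 + (Real.exp u - 1) / t * z := by
  set w := min z t / t with hw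
  have hw0 : 0 ≤ w := div_nonneg (le_min hz ht.le) ht.le
  have hw1 : w ≤ 1 := (div_le_one ht).2 (min_le_right _ _)
  have hwz : w ≤ z / t := div_le_div_of_nonneg_right (min_le_left _ _) ht.le
  have h := convexOn_exp.2 (Set.mem_univ 0) (Set.mem_univ u) (sub_nonneg.2 hw1) hw0 (by ring)
  simp only [smul_eq_mul, mul_zero, zero_add, Real.exp_zero, mul_one] at h
  have he : 1 ≤ Real.exp u := Real.one_le_exp hu
  calc Real.exp (u / t * min z t) = Real.exp (w * u) := by rw [hw]; congr 1; ring
    _ ≤ 1 + (Real.exp u - 1) * w := by linarith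
    _ ≤ 1 + (Real.exp u - 1) * (z / t) := by
        have := mul_le_mul_of_nonneg_left hwz (sub_nonneg.2 he)
        linarith
    _ = _ := by ring

theorem exp_min_le_quadratic {z t : ℝ} (hz : 0 ≤ z) (ht : 0 < t) :
    Real.exp (1 / t * min z t) ≤ 1 + 1 / t * z + 1 / t ^ 2 * z ^ 2 := by
  set w := min z t / t with hw
  have hw0 : 0 ≤ w := div_nonneg (le_min hz ht.le) ht.le
  have hw1 : w ≤ 1 := (div_le_one ht).2 (min_le_right _ _)
  have hwz : w ≤ z / t := div_le_div_of_nonneg_right (min_le_left _ _) ht.le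
  have h := (abs_le.1 (Real.abs_exp_sub_one_sub_id_le (abs_le.2 ⟨by linarith, hw1⟩))).2
  calc Real.exp (1 / t * min z t) = Real.exp w := by rw [hw]; congr 1; ring
    _ ≤ 1 + w + w ^ 2 := by linarith
    _ ≤ 1 + z / t + (z / t) ^ 2 := by gcongr
    _ = _ := by ring

/-- For `z ≥ t` the right side is at least 1, so the quadratic term also pays for the mean lost by
truncation. -/
theorem exp_neg_min_le_quadratic {z t : ℝ} (hz : 0 ≤ z) (ht : 0 < t) :
    Real.exp (-(1 / t) * min z t) ≤ 1 + -(1 / t) * z + 2 / t ^ 2 * z ^ 2 := by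
  have e : 1 + -(1 / t) * z + 2 / t ^ 2 * z ^ 2 = 1 - z / t + 2 * (z / t) ^ 2 := by ring
  have hv : 0 ≤ z / t := div_nonneg hz ht.le
  rw [e]
  rcases le_total z t with h | h
  · rw [min_eq_left h, show -(1 / t) * z = -(z / t) by ring]
    have h1 : z / t ≤ 1 := (div_le_one ht).2 h
    have h2 := (abs_le.1 (Real.abs_exp_sub_one_sub_id_le (x := -(z / t))
      (abs_le.2 ⟨by linarith, by linarith⟩))).2
    nlinarith [sq_nonneg (z / t)]
  · rw [min_eq_right h]
    have h1 : 1 ≤ z / t := (one_le_div ht).2 h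
    have h2 : Real.exp (-(1 / t) * t) ≤ 1 := Real.exp_le_one_iff.2 (by
      rw [neg_mul, one_div, inv_mul_cancel₀ ht.ne']; norm_num)
    nlinarith

/-- At distance `k` from the true level the threshold beats the tilted mean because 4 exceeds `e`.
The inequality fails at `k = 3`, which is why `exists_chernoff_params` splits at 4. -/
theorem eight_mul_exp_le {k : ℕ} (hk : 4 ≤ k) : 8 * Real.exp k ≤ k / 2 * 4 ^ k := by
  induction k, hk using Nat.le_induction with
  | base =>
    have h : Real.exp ((4 : ℕ) : ℝ) = Real.exp 1 ^ 4 := by rw [← Real.exp_nat_mul]; norm_num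
    rw [h]
    have : Real.exp 1 ^ 4 ≤ 2.7182818286 ^ 4 :=
      pow_le_pow_left₀ (Real.exp_pos _).le Real.exp_one_lt_d9.le 4
    norm_num at this ⊢
    linarith
  | succ k hk ih =>
    have h1 : Real.exp 1 ≤ 4 := Real.exp_one_lt_d9.le.trans (by norm_num)
    push_cast
    rw [Real.exp_add, pow_succ]
    calc 8 * (Real.exp k * Real.exp 1) = (8 * Real.exp k) * Real.exp 1 := by ring
      _ ≤ (k / 2 * 4 ^ k) * 4 := by gcongr
      _ ≤ (k + 1) / 2 * (4 ^ k * 4) := by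
          have : (0 : ℝ) < 4 ^ k := by positivity
          nlinarith

/-- Chernoff parameters for the samples of level `i`, which estimate the density `μ` under the
hypothesis that it is about `4 ^ (-i)`. The true level of `μ` is `i + k`. The events on the mean
`y` of the samples that are excluded are an inaccurate estimate at or above the threshold of the
level, and, at the true level, an estimate below the threshold. -/
theorem exists_chernoff_params {D ε μ L : ℝ} (hD : 1 ≤ D) (hε : 0 < ε) (hε1 : ε ≤ 1)
    (hμ : 0 < μ) (hL : 1 ≤ L) {N : ℕ} (hN : 36864 * D * L ≤ N * ε ^ 2) {i k : ℕ}
    (hlow : 2 ≤ μ * 4 ^ (i + k)) (hup : μ * 4 ^ (i + k) ≤ 8) :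
    ∃ s c a b : Bool → ℝ, ∀ ι, 0 ≤ b ι ∧
      (∀ z, 0 ≤ z → Real.exp (s ι * min z (24 * D / ε / 2 ^ i)) ≤ 1 + a ι * z + b ι * z ^ 2) ∧
      c ι + (N * 2 ^ i : ℕ) * (a ι * μ + b ι * (D * μ * √μ)) ≤ -(3 * L * (k + 1)) ∧
      ∀ S : ℝ, ((1 : ℝ) / 4 ^ i ≤ 1 / (N * 2 ^ i : ℕ) * S ∧ ε * μ ≤ |1 / (N * 2 ^ i : ℕ) * S - μ|) ∨
        (k = 0 ∧ 1 / (N * 2 ^ i : ℕ) * S < (1 : ℝ) / 4 ^ i) →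
        0 ≤ s true * S + c true ∨ 0 ≤ s false * S + c false := by
  have hNpos : (0 : ℝ) < N := by
    have : (0 : ℝ) < N * ε ^ 2 := lt_of_lt_of_le (by positivity) hN
    exact pos_of_mul_pos_left this (by positivity)
  set X : ℝ := 2 ^ i with hX
  have hXpos : 0 < X := by positivity
  have e4 : (4 : ℝ) ^ i = X ^ 2 := by rw [hX, ← pow_mul, mul_comm, pow_mul]; norm_num
  have hn : ((N * 2 ^ i : ℕ) : ℝ) = N * X := by push_cast; rfl
  rw [pow_add, e4] at hlow hup
  rw [hn, e4]
  set t : ℝ := 24 * D / ε / X with ht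
  have htpos : 0 < t := by positivity
  have h4 : (0 : ℝ) < 4 ^ k := by positivity
  rcases le_or_gt 4 k with hk | hk
  -- Far from the true level, reaching the threshold is already unlikely, so accuracy is ignored.
  -- Both indices carry the same upper tail, with tilt `k / t`, normalized to exponent 0 when the
  -- average equals the threshold.
  · refine ⟨fun _ => k / t, fun _ => -(k * (N * X) / (t * X ^ 2)), fun _ => (Real.exp k - 1) / t,
      fun _ => 0, fun _ => ⟨le_rfl, fun z hz => ?_, ?_, fun S hS => Or.inl ?_⟩⟩
    · simpa using exp_mul_min_le_linear hz htpos k.cast_nonneg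
    · have h1 := eight_mul_exp_le hk
      have h2 : μ * X ^ 2 * Real.exp k ≤ k / 2 := by
        refine le_of_mul_le_mul_right ?_ h4
        calc μ * X ^ 2 * Real.exp k * 4 ^ k = (μ * (X ^ 2 * 4 ^ k)) * Real.exp k := by ring
          _ ≤ 8 * Real.exp k := by gcongr
          _ ≤ _ := h1
      have h3 : 1536 * L ≤ N * X / (t * X ^ 2) := by
        have : N * X / (t * X ^ 2) = N * ε / (24 * D) := by
          rw [ht]; field_simp
        rw [this, le_div_iff₀ (by positivity)]
        have : (N : ℝ) * ε ^ 2 ≤ N * ε := by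
          have : ε ^ 2 ≤ ε := by nlinarith
          gcongr
        linarith
      have hk' : (4 : ℝ) ≤ k := by exact_mod_cast hk
      calc _ = N * X / (t * X ^ 2) * (μ * X ^ 2 * Real.exp k - μ * X ^ 2 - k) := by
            field_simp; ring
        _ ≤ N * X / (t * X ^ 2) * (-(k / 2)) := by
            have : 0 ≤ μ * X ^ 2 := by positivity
            gcongr
            linarith
        _ ≤ 1536 * L * (-(k / 2)) := by
            have := mul_le_mul_of_nonneg_right h3 (show (0 : ℝ) ≤ k / 2 by positivity)
            linarith
        _ ≤ _ := by nlinarith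
    · rcases hS with hS | hS
      · have h1 := hS.1
        have h2 : (0 : ℝ) ≤ k * (N * X) / t := by positivity
        have h3 := mul_le_mul_of_nonneg_left h1 h2
        have e1 : (k : ℝ) * (N * X) / t * (1 / (N * X) * S) = k / t * S := by field_simp
        have e2 : (k : ℝ) * (N * X) / t * (1 / X ^ 2) = k * (N * X) / (t * X ^ 2) := by field_simp
        rw [e1, e2] at h3
        linarith
      · omega
  · have hk3 : (4 : ℝ) ^ k ≤ 64 := by
      calc (4 : ℝ) ^ k ≤ 4 ^ 3 := pow_le_pow_right₀ (by norm_num) (by omega)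
        _ = 64 := by norm_num
    have hk3' : (k : ℝ) ≤ 3 := by exact_mod_cast (show k ≤ 3 by omega)
    have h1 : (1 : ℝ) ≤ 4 ^ k := one_le_pow₀ (by norm_num)
    have hμX : 1 / 32 ≤ μ * X ^ 2 := by
      have := mul_le_mul_of_nonneg_left hk3 (show 0 ≤ μ * X ^ 2 by positivity)
      linarith
    have hμX' : μ * X ^ 2 ≤ 8 := by
      have := mul_le_mul_of_nonneg_left h1 (show 0 ≤ μ * X ^ 2 by positivity)
      linarith
    have hsq : √μ * X ≤ 3 := by
      refine abs_le_of_sq_le_sq' ?_ (by norm_num) |>.2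
      rw [mul_pow, Real.sq_sqrt hμ.le]
      linarith
    -- The constant 24 in `t` is chosen for this: with `√μ * X ≤ 3` the second-moment term is a
    -- small part of the deviation `ε * μ / 2`.
    have hV : D * μ * √μ / t ≤ ε * μ / 8 := by
      have : D * μ * √μ / t = ε * μ / 24 * (√μ * X) := by rw [ht]; field_simp
      rw [this]
      have := mul_le_mul_of_nonneg_left hsq (show 0 ≤ ε * μ / 24 by positivity)
      linarith
    have hexp : 12 * L ≤ N * X / t * (ε * μ / 4) := by
      have : N * X / t * (ε * μ / 4) = N * ε ^ 2 / (96 * D) * (μ * X ^ 2) := by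
        rw [ht]; field_simp; ring
      rw [this]
      have : 384 * L ≤ N * ε ^ 2 / (96 * D) := by
        rw [le_div_iff₀ (by positivity)]
        linarith
      calc 12 * L = 384 * L * (1 / 32) := by ring
        _ ≤ _ := by gcongr
    have hfin : -(12 * L) ≤ -(3 * L * (k + 1)) := by nlinarith
    have hnt : 0 ≤ N * X / t := by positivity
    have hprod := mul_le_mul_of_nonneg_left hV hnt
    have hS' : ∀ S : ℝ, (1 / X ^ 2 ≤ 1 / (N * X) * S ∧ ε * μ ≤ |1 / (N * X) * S - μ|) ∨
        (k = 0 ∧ 1 / (N * X) * S < 1 / X ^ 2) →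
        0 ≤ 1 / t * S + -(N * X * (μ + ε * μ / 2) / t) ∨
        0 ≤ -(1 / t) * S + N * X * (μ - ε * μ / 2) / t := by
      intro S hS
      have e : 1 / t * S = N * X / t * (1 / (N * X) * S) := by field_simp
      rw [neg_mul, e]
      set y := 1 / (N * X) * S
      have hεμ : 0 < ε * μ := by positivity
      -- Half the accuracy suffices for both events: an average below the threshold of the true
      -- level is below `μ / 2`, hence off by at least `ε * μ / 2`.
      have hdev : ε * μ / 2 ≤ |y - μ| := by
        rcases hS with hS | ⟨rfl, hS⟩
        · linarith [hS.2]
        · have h2 : 1 / X ^ 2 ≤ μ / 2 := by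
            rw [pow_zero, mul_one] at hlow
            rw [div_le_iff₀ (by positivity)]
            linarith
          have h3 : ε * μ ≤ 1 * μ := by gcongr
          rw [abs_sub_comm]
          exact le_trans (by linarith) (le_abs_self _)
      rcases le_abs.1 hdev with h | h
      · left
        have := mul_nonneg hnt (show 0 ≤ y - (μ + ε * μ / 2) by linarith)
        have e2 : N * X / t * (y - (μ + ε * μ / 2)) =
          N * X / t * y + -(N * X * (μ + ε * μ / 2) / t) := by ring
        linarith
      · right
        have := mul_nonneg hnt (show 0 ≤ μ - ε * μ / 2 - y by linarith)
        have e2 : N * X / t * (μ - ε * μ / 2 - y) =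
          -(N * X / t * y) + N * X * (μ - ε * μ / 2) / t := by ring
        linarith
    -- Near the true level `true` is the upper tail and `false` the lower, each normalized to
    -- exponent 0 at deviation `ε * μ / 2`.
    refine ⟨fun ι => if ι then 1 / t else -(1 / t),
      fun ι => if ι then -(N * X * (μ + ε * μ / 2) / t) else N * X * (μ - ε * μ / 2) / t,
      fun ι => if ι then 1 / t else -(1 / t), fun ι => if ι then 1 / t ^ 2 else 2 / t ^ 2,
      fun ι => ⟨?_, fun z hz => ?_, ?_, fun S hS => ?_⟩⟩
    · cases ι <;> simp <;> positivity
    · cases ι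
      · simpa using exp_neg_min_le_quadratic hz htpos
      · simpa using exp_min_le_quadratic hz htpos
    · cases ι
      · simp only [Bool.false_eq_true, if_false]
        have e : N * X * (μ - ε * μ / 2) / t +
            N * X * (-(1 / t) * μ + 2 / t ^ 2 * (D * μ * √μ)) =
            2 * (N * X / t * (D * μ * √μ / t)) - N * X / t * (ε * μ / 2) := by
          field_simp; ring
        rw [e]
        linarith
      · simp only [if_true]
        have e : -(N * X * (μ + ε * μ / 2) / t) +
            N * X * (1 / t * μ + 1 / t ^ 2 * (D * μ * √μ)) =
            N * X / t * (D * μ * √μ / t) - N * X / t * (ε * μ / 2) := by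
          field_simp; ring
        rw [e]
        linarith
    · simpa using hS' S hS

end

noncomputable section

/-! ## Scans in levels of doubling length -/

/-- The level of sample `j`: level `i` consists of `N * 2 ^ i` samples. -/
def levelIndex (N j : ℕ) : ℕ := Nat.log 2 ((j + N) / N)

theorem levelIndex_eq {N i j : ℕ} (h1 : N * 2 ^ i ≤ j + N) (h2 : j + N < N * 2 ^ (i + 1)) :
    levelIndex N j = i := by
  have hN : 0 < N := Nat.pos_of_ne_zero (by rintro rfl; simp at h2)
  refine Nat.log_eq_of_pow_le_of_lt_pow ?_ ?_
  · rwa [Nat.le_div_iff_mul_le hN, mul_comm]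
  · rwa [Nat.div_lt_iff_lt_mul hN, mul_comm]

/-- The scan that averages the samples of each level `i`, truncated at `c / 2 ^ i`, and stops if the
average is at least `1 / 4 ^ i`. -/
def levelScan (N : ℕ) (c : ℝ) : ScanParams where
  trunc j := c / 2 ^ levelIndex N j
  carry j := if j + N = N * 2 ^ levelIndex N j then 0 else 1
  scale j := if j + N + 1 = N * 2 ^ (levelIndex N j + 1) then
    1 / (N * 2 ^ levelIndex N j : ℕ) else 0
  thr j := if j + N + 1 = N * 2 ^ (levelIndex N j + 1) then 1 / 4 ^ levelIndex N j else 1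

theorem ofReal_exp_mul_add_add (s x y c : ℝ) : ENNReal.ofReal (Real.exp (s * (x + y) + c)) =
    ENNReal.ofReal (Real.exp (s * y)) * ENNReal.ofReal (Real.exp (s * x + c)) := by
  rw [← ENNReal.ofReal_mul (Real.exp_pos _).le, ← Real.exp_add]
  congr 2
  ring

/-- If the outcome of the last sample of a level is controlled by exponentials of the sum, then the
failure probability is controlled by products of exponential moments. -/
theorem failProb_level_le {q : ℕ → PMF ℝ} {bad : Set ℝ} {N i m : ℕ} {c : ℝ} {s e : Bool → ℝ}
    {G : Bool → ℕ → ℝ≥0∞} {R : ℝ≥0∞}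
    (hG : ∀ ι j, (q j).expect (fun z => ENNReal.ofReal (Real.exp (s ι * min z (c / 2 ^ i)))) ≤ G ι j)
    (hend : ∀ (S : ℝ) (j : ℕ), j + N = N * 2 ^ (i + 1) →
      (if 1 / 4 ^ i ≤ 1 / (N * 2 ^ i : ℕ) * S then bad.indicator 1 (1 / (N * 2 ^ i : ℕ) * S)
        else (levelScan N c).failProb q bad m j S) ≤
      ∑ ι, ENNReal.ofReal (Real.exp (s ι * S + e ι)) + R) (u : ℕ) {j : ℕ}
    (hj : N * 2 ^ i ≤ j + N) (hu : j + N + u + 1 = N * 2 ^ (i + 1)) (S : ℝ) :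
    (levelScan N c).failProb q bad (m + u + 1) j S ≤
      ∑ ι, ENNReal.ofReal (Real.exp (s ι * ((levelScan N c).carry j * S) + e ι)) *
        ∏ v ∈ Finset.range (u + 1), G ι (j + v) + R := by
  induction u generalizing j S with
  | zero =>
    have hi := levelIndex_eq (N := N) (i := i) (j := j) hj (by omega)
    have ht : (levelScan N c).trunc j = c / 2 ^ i := by simp [levelScan, hi]
    have hs : (levelScan N c).scale j = 1 / (N * 2 ^ i : ℕ) := by
      simp only [levelScan, hi]; rw [if_pos (by omega)]
    have hr : (levelScan N c).thr j = 1 / 4 ^ i := by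
      simp only [levelScan, hi]; rw [if_pos (by omega)]
    rw [ScanParams.failProb, hs, hr]
    refine (PMF.expect_mono fun z => hend _ (j + 1) (by omega)).trans ?_
    rw [PMF.expect_add, PMF.expect_const, PMF.expect_finset_sum]
    refine add_le_add_left (Finset.sum_le_sum fun ι _ => ?_) _
    simp only [ScanParams.next, ofReal_exp_mul_add_add, PMF.expect_mul_const, ht, zero_add,
      Finset.prod_range_one, add_zero]
    rw [mul_comm]
    exact mul_le_mul_right (hG ι j) _
  | succ u ih =>
    have hi := levelIndex_eq (N := N) (i := i) (j := j) hj (by omega)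
    have ht : (levelScan N c).trunc j = c / 2 ^ i := by simp [levelScan, hi]
    have hs : (levelScan N c).scale j = 0 := by
      simp only [levelScan, hi]; rw [if_neg (by omega)]
    have hr : (levelScan N c).thr j = 1 := by
      simp only [levelScan, hi]; rw [if_neg (by omega)]
    have hi' := levelIndex_eq (N := N) (i := i) (j := j + 1) (by omega) (by omega)
    have hc : (levelScan N c).carry (j + 1) = 1 := by
      simp only [levelScan, hi']; rw [if_neg (by omega)]
    rw [ScanParams.failProb]
    -- Before the last sample of a level the scan compares 0 with 1 and so never stops.
    simp only [hs, hr, zero_mul, not_le.2 (zero_lt_one' ℝ), if_false]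
    refine (PMF.expect_mono fun z => ih (j := j + 1) (by omega) (by omega) _).trans ?_
    rw [PMF.expect_add, PMF.expect_const, PMF.expect_finset_sum]
    refine add_le_add_left (Finset.sum_le_sum fun ι _ => ?_) _
    simp only [hc, one_mul, ScanParams.next, ofReal_exp_mul_add_add, PMF.expect_mul_const, ht]
    rw [Finset.prod_range_succ' _ (u + 1), add_zero]
    have e1 : ∀ v, j + 1 + v = j + (v + 1) := fun v => by omega
    simp only [e1]
    calc _ ≤ G ι j * _ * _ := mul_le_mul_left (mul_le_mul_left (hG ι j) _) _
      _ = _ := by ring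

/-- The failure probability of a scan that is to stop with a value outside of `bad` at level `I` or
earlier is at most the sum of the failure probabilities of the levels. -/
theorem failProb_levelScan_le {q : ℕ → PMF ℝ} {bad : Set ℝ} {N I : ℕ} {c : ℝ} (hN : 0 < N)
    {s e : ℕ → Bool → ℝ} {G : ℕ → Bool → ℕ → ℝ≥0∞}
    (hG : ∀ k ≤ I, ∀ ι j, (q j).expect
      (fun z => ENNReal.ofReal (Real.exp (s k ι * min z (c / 2 ^ (I - k))))) ≤ G k ι j)
    (hend : ∀ k ≤ I, ∀ S : ℝ, (1 / 4 ^ (I - k) ≤ 1 / (N * 2 ^ (I - k) : ℕ) * S ∧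
        1 / (N * 2 ^ (I - k) : ℕ) * S ∈ bad) ∨
        (k = 0 ∧ 1 / (N * 2 ^ (I - k) : ℕ) * S < 1 / 4 ^ (I - k)) →
      0 ≤ s k true * S + e k true ∨ 0 ≤ s k false * S + e k false) :
    (levelScan N c).failProb q bad (N * 2 ^ (I + 1) - N) 0 0 ≤
      ∑ k ∈ Finset.range (I + 1), ∑ ι, ENNReal.ofReal (Real.exp (e k ι)) *
        ∏ v ∈ Finset.range (N * 2 ^ (I - k)), G k ι (N * 2 ^ (I - k) - N + v) := by
  have hpow : ∀ i, N ≤ N * 2 ^ i := fun i => Nat.le_mul_of_pos_right _ (by positivity)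
  have hexp : ∀ k ≤ I, ∀ S : ℝ, (1 / 4 ^ (I - k) ≤ 1 / (N * 2 ^ (I - k) : ℕ) * S ∧
        1 / (N * 2 ^ (I - k) : ℕ) * S ∈ bad) ∨
        (k = 0 ∧ 1 / (N * 2 ^ (I - k) : ℕ) * S < 1 / 4 ^ (I - k)) →
      1 ≤ ∑ ι, ENNReal.ofReal (Real.exp (s k ι * S + e k ι)) := by
    intro k hk S hS
    rw [Fintype.sum_bool]
    rcases hend k hk S hS with h | h
    · exact le_add_right (ENNReal.one_le_ofReal.2 (Real.one_le_exp h))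
    · exact le_add_left (ENNReal.one_le_ofReal.2 (Real.one_le_exp h))
  -- Backward induction from the true level. The bound is uniform in the incoming sum `S`, because
  -- the carry is 0 at the start of a level; hence the failure bounds of the levels simply add up.
  suffices H : ∀ k ≤ I, ∀ j m, j + N = N * 2 ^ (I - k) → j + N + m = N * 2 ^ (I + 1) → ∀ S,
      (levelScan N c).failProb q bad m j S ≤
      ∑ k ∈ Finset.range (k + 1), ∑ ι, ENNReal.ofReal (Real.exp (e k ι)) *
        ∏ v ∈ Finset.range (N * 2 ^ (I - k)), G k ι (N * 2 ^ (I - k) - N + v) by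
    refine H I le_rfl 0 _ (by simp) ?_ 0
    have := hpow (I + 1)
    omega
  intro k
  induction k with
  | zero =>
    intro _ j m hj hm S
    obtain ⟨u, hu⟩ : ∃ u, N * 2 ^ (I - 0) = u + 1 := ⟨N * 2 ^ (I - 0) - 1, by
      have := hpow (I - 0); omega⟩
    have hp : N * 2 ^ (I + 1) = N * 2 ^ (I - 0) + N * 2 ^ (I - 0) := by
      rw [Nat.sub_zero, pow_succ]; ring
    obtain rfl : m = 0 + u + 1 := by omega
    refine (failProb_level_le (N := N) (j := j) (i := I - 0) (s := s 0) (e := e 0) (R := 0) (hG 0 (Nat.zero_le _))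
      (fun S' j' _ => ?_) u (by omega) (by rw [Nat.sub_zero] at *; omega) S).trans ?_
    · rw [add_zero]
      split_ifs with h
      · by_cases hb : 1 / ((N * 2 ^ (I - 0) : ℕ) : ℝ) * S' ∈ bad
        · rw [Set.indicator_of_mem hb]
          exact hexp 0 (Nat.zero_le _) S' (Or.inl ⟨h, hb⟩)
        · rw [Set.indicator_of_notMem hb]
          exact zero_le
      -- After the true level no budget is left, so not stopping there is a failure.
      · exact hexp 0 (Nat.zero_le _) S' (Or.inr ⟨rfl, not_le.1 h⟩)
    · have hc : (levelScan N c).carry j = 0 := by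
        have := levelIndex_eq (N := N) (i := I - 0) (j := j) (by omega) (by rw [Nat.sub_zero] at *; omega)
        simp only [levelScan, this]
        rw [if_pos hj]
      rw [Finset.sum_range_one, add_zero, hc, ← hu]
      simp only [zero_mul, mul_zero, zero_add]
      rw [show j = N * 2 ^ (I - 0) - N by omega]
  | succ k ih =>
    intro hk j m hj hm S
    obtain ⟨u, hu⟩ : ∃ u, N * 2 ^ (I - (k + 1)) = u + 1 := ⟨N * 2 ^ (I - (k + 1)) - 1, by
      have := hpow (I - (k + 1)); omega⟩
    have hI : I - k = I - (k + 1) + 1 := by omega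
    have hp : N * 2 ^ (I - k) = N * 2 ^ (I - (k + 1)) + N * 2 ^ (I - (k + 1)) := by
      rw [hI, pow_succ]; ring
    have hle : N * 2 ^ (I - k) ≤ N * 2 ^ (I + 1) :=
      Nat.mul_le_mul_left _ (Nat.pow_le_pow_right (by omega) (by omega))
    obtain ⟨m, rfl⟩ : ∃ m', m = m' + u + 1 := ⟨m - u - 1, by omega⟩
    rw [Finset.sum_range_succ, add_comm (Finset.sum _ _)]
    refine (failProb_level_le (N := N) (j := j) (i := I - (k + 1)) (s := s (k + 1)) (e := e (k + 1)) (hG (k + 1) hk)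
      (fun S' j' hj' => ?_) u (by omega) (by rw [hI] at hp; omega) S).trans
      (add_le_add_left (le_of_eq ?_) _)
    · rw [← hI] at hj'
      split_ifs with h
      · by_cases hb : 1 / ((N * 2 ^ (I - (k + 1)) : ℕ) : ℝ) * S' ∈ bad
        · rw [Set.indicator_of_mem hb]
          exact le_add_right (hexp (k + 1) hk S' (Or.inl ⟨h, hb⟩))
        · rw [Set.indicator_of_notMem hb]
          exact zero_le
      · exact le_add_left (ih (by omega) j' m hj' (by omega) S')
    · have hc : (levelScan N c).carry j = 0 := by
        have := levelIndex_eq (N := N) (i := I - (k + 1)) (j := j) (by omega) (by rw [hI] at hp; omega)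
        simp only [levelScan, this]
        rw [if_pos hj]
      rw [hc, ← hu]
      simp only [zero_mul, mul_zero, zero_add]
      rw [show j = N * 2 ^ (I - (k + 1)) - N by omega]

/-- The offset `o` is the position at which a level starts in the sequence of hash functions. -/
theorem lintegral_prod_range_infinitePi {H : Type u} [MeasurableSpace H] (ν : Measure H)
    [IsProbabilityMeasure ν] {F : H → ℝ≥0∞} (hF : Measurable F) (o n : ℕ) :
    ∫⁻ ω : ℕ → H, ∏ v ∈ Finset.range n, F (ω (o + v)) ∂Measure.infinitePi (fun _ => ν) =
      (∫⁻ h, F h ∂ν) ^ n := by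
  have hind : ProbabilityTheory.iIndepFun (fun (v : ℕ) (ω : ℕ → H) => F (ω v))
      (Measure.infinitePi fun _ => ν) :=
    ProbabilityTheory.iIndepFun_infinitePi (X := fun _ => F) fun _ => hF
  have hind' := hind.precomp (g := fun v => o + v) (add_right_injective o)
  rw [ProbabilityTheory.lintegral_prod_eq_prod_lintegral_of_indepFun (Finset.range n)
    (fun v (ω : ℕ → H) => F (ω (o + v))) hind' fun v => hF.comp (measurable_pi_apply _)]
  have h1 : ∀ v : ℕ, ∫⁻ ω : ℕ → H, F (ω v) ∂Measure.infinitePi (fun _ => ν) = ∫⁻ h, F h ∂ν :=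
    fun v => (measurePreserving_eval_infinitePi (fun _ : ℕ => ν) v).lintegral_comp hF
  simp [h1]

end

noncomputable section

/-! ## The data structure -/

/-- The lower bound 2 puts the threshold at or below half the density. Minimality makes the level
antitone in `μ`, so the levels stored for `τ` suffice for larger densities. -/
theorem exists_level {μ : ℝ} (hμ : 0 < μ) (hμ1 : μ ≤ 1) :
    ∃ I : ℕ, 2 ≤ μ * 4 ^ I ∧ μ * 4 ^ I ≤ 8 ∧ ∀ K : ℕ, 2 ≤ μ * 4 ^ K → I ≤ K := by
  have hex : ∃ I : ℕ, 2 ≤ μ * 4 ^ I := by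
    obtain ⟨I, hI⟩ := pow_unbounded_of_one_lt (2 / μ) (show (1 : ℝ) < 4 by norm_num)
    refine ⟨I, ?_⟩
    rw [div_lt_iff₀ hμ] at hI
    linarith
  refine ⟨Nat.find hex, Nat.find_spec hex, ?_, fun K hK => Nat.find_min' hex hK⟩
  rcases Nat.eq_zero_or_pos (Nat.find hex) with h | h
  · rw [h]
    linarith
  · have := Nat.find_min hex (Nat.sub_lt h one_pos)
    obtain ⟨m, hm⟩ : ∃ m, Nat.find hex = m + 1 := ⟨Nat.find hex - 1, by omega⟩
    rw [hm, Nat.add_sub_cancel, not_le] at this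
    rw [hm, pow_succ]
    linarith

/-- Since `L ≥ 1`, the exponent `3 * L * (k + 1)` is at least `L + 2 * (k + 1)`: the first part
yields `δ`, the second a convergent geometric series. The factor 2 counts the two tails. -/
theorem sum_two_mul_exp_le {L δ : ℝ} (hL : 1 ≤ L) (hδ : 0 < δ) (hLδ : Real.log (1 / δ) ≤ L)
    (m : ℕ) : ∑ k ∈ Finset.range m, 2 * Real.exp (-(3 * L * (k + 1))) ≤ δ := by
  have h1 : Real.exp (-L) ≤ δ := by
    rw [one_div, Real.log_inv] at hLδ
    calc Real.exp (-L) ≤ Real.exp (Real.log δ) := Real.exp_le_exp.2 (by linarith)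
      _ = δ := Real.exp_log hδ
  have h2 : Real.exp (-2) ≤ 1 / 4 := by
    rw [Real.exp_neg, ← one_div]
    refine one_div_le_one_div_of_le (by norm_num) ?_
    have h3 : Real.exp 2 = Real.exp 1 ^ 2 := by rw [← Real.exp_nat_mul]; norm_num
    have h4 := Real.exp_one_gt_d9
    rw [h3]
    nlinarith
  have h3 : ∀ k : ℕ, 2 * Real.exp (-(3 * L * (k + 1))) ≤ δ * (2 * (1 / 4) ^ (k + 1)) := by
    intro k
    have hk : (0 : ℝ) ≤ k := k.cast_nonneg
    calc 2 * Real.exp (-(3 * L * (k + 1))) ≤ 2 * Real.exp (-L + (k + 1 : ℕ) * (-2)) := by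
          gcongr
          push_cast
          nlinarith
      _ = Real.exp (-L) * (2 * Real.exp (-2) ^ (k + 1)) := by
          rw [Real.exp_add, Real.exp_nat_mul]
          ring
      _ ≤ _ := by gcongr
  have h4 : ∀ m : ℕ, ∑ k ∈ Finset.range m, 2 * (1 / 4 : ℝ) ^ (k + 1) = 2 / 3 * (1 - (1 / 4) ^ m) := by
    intro m
    induction m with
    | zero => simp
    | succ m ih => rw [Finset.sum_range_succ, ih]; ring
  calc _ ≤ ∑ k ∈ Finset.range m, δ * (2 * (1 / 4) ^ (k + 1)) := Finset.sum_le_sum fun k _ => h3 k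
    _ = δ * (2 / 3 * (1 - (1 / 4) ^ m)) := by rw [← Finset.mul_sum, h4]
    _ ≤ δ * 1 := by
        have : (0 : ℝ) ≤ (1 / 4) ^ m := by positivity
        gcongr
        linarith
    _ = δ := mul_one δ

section Failure

variable {d n : ℕ} {H : Type u} [MeasurableSpace H] {B : Type v}
  {k : EuclideanSpace ℝ (Fin d) → EuclideanSpace ℝ (Fin d) → ℝ} {ν : Measure H}
  [IsProbabilityMeasure ν] {hash : H → EuclideanSpace ℝ (Fin d) → B}
  {P : Fin n → EuclideanSpace ℝ (Fin d)} {x : EuclideanSpace ℝ (Fin d)}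

/-- For independent hash functions, the scan in levels returns an accurate estimate at the true level
of the density or earlier, except with probability `δ`. -/
theorem exists_measurable_failProb_le (hm : ∀ i, MeasurableSet {h | hash h (P i) = hash h x})
    (hk : ∀ x y, 0 ≤ k x y) {M ε δ L : ℝ} (hM : 1 ≤ M)
    (hlow : ∀ i, M⁻¹ * √(k x (P i)) ≤ collisionProb ν hash x (P i))
    (hup : ∀ i, collisionProb ν hash x (P i) ≤ M * √(k x (P i)))
    (hε : 0 < ε) (hε1 : ε ≤ 1) (hδ : 0 < δ) (hL : 1 ≤ L) (hLδ : Real.log (1 / δ) ≤ L)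
    {N I : ℕ} (hN : 36864 * M ^ 3 * L ≤ N * ε ^ 2) (hpos : 0 < kde k P x)
    (hI : 2 ≤ kde k P x * 4 ^ I) (hI8 : kde k P x * 4 ^ I ≤ 8) :
    ∃ g : (ℕ → H) → ℝ≥0∞, Measurable g ∧
      (∀ ω, (levelScan N (24 * M ^ 3 / ε)).failProb (fun j => hbeLaw k ν hash P (ω j) x)
        {a | ε * kde k P x ≤ |a - kde k P x|} (N * 2 ^ (I + 1) - N) 0 0 ≤ g ω) ∧
      ∫⁻ ω, g ω ∂Measure.infinitePi (fun _ => ν) ≤ ENNReal.ofReal δ := by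
  have hD : 1 ≤ M ^ 3 := one_le_pow₀ hM
  have hNpos : 0 < N := by
    rcases Nat.eq_zero_or_pos N with rfl | h
    · have : 0 < 36864 * M ^ 3 * L := by positivity
      simp only [Nat.cast_zero, zero_mul] at hN
      linarith
    · exact h
  have hex : ∀ j, j ≤ I → _ := fun j hj =>
    exists_chernoff_params hD hε hε1 hpos hL hN (i := I - j) (k := j)
      (by rwa [Nat.sub_add_cancel hj]) (by rwa [Nat.sub_add_cancel hj])
  choose! s e a b h using hex
  have hmean : ∫ h, hbeMean k ν hash P x h ∂ν = kde k P x := by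
    refine integral_hbeMean hm fun i hi => ?_
    have h1 := hlow i
    rw [hi] at h1
    have h2 : √(k x (P i)) ≤ 0 := by
      by_contra hlt
      rw [not_le] at hlt
      have : 0 < M⁻¹ * √(k x (P i)) := by positivity
      linarith
    exact le_antisymm (Real.sqrt_eq_zero'.1 (le_antisymm h2 (Real.sqrt_nonneg _))) (hk _ _)
  have hV := integral_hbeSqMean_le hm hk (by positivity) hlow hup
  set F : ℕ → Bool → H → ℝ≥0∞ := fun j ι h => ENNReal.ofReal
    (1 + a j ι * hbeMean k ν hash P x h + b j ι * hbeSqMean k ν hash P x h) with hF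
  have hFm : ∀ j ι, Measurable (F j ι) := fun j ι => ENNReal.measurable_ofReal.comp
    ((measurable_const.add ((measurable_hbeMean hm).const_mul _)).add
      ((measurable_hbeSqMean hm).const_mul _))
  have hprod : ∀ j ι, Measurable fun ω : ℕ → H =>
      ∏ v ∈ Finset.range (N * 2 ^ (I - j)), F j ι (ω (N * 2 ^ (I - j) - N + v)) := fun j ι =>
    Finset.measurable_prod _ fun v _ => (hFm j ι).comp (measurable_pi_apply _)
  refine ⟨fun ω => ∑ j ∈ Finset.range (I + 1), ∑ ι, ENNReal.ofReal (Real.exp (e j ι)) *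
    ∏ v ∈ Finset.range (N * 2 ^ (I - j)), F j ι (ω (N * 2 ^ (I - j) - N + v)), ?_, fun ω => ?_, ?_⟩
  · exact Finset.measurable_sum _ fun j _ => Finset.measurable_sum _ fun ι _ =>
      (hprod j ι).const_mul _
  · refine failProb_levelScan_le (G := fun j ι v => F j ι (ω v)) (s := s) hNpos
      (fun j hj ι v => ?_) fun j hj S hS => (h j hj true).2.2.2 S hS
    exact expect_hbeLaw_le hk _ (fun z => (Real.exp_pos _).le) (h j hj ι).2.1
  · rw [lintegral_finsetSum _ fun j _ => Finset.measurable_sum _ fun ι _ =>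
      (hprod j ι).const_mul _]
    refine le_trans ?_ (ENNReal.ofReal_le_ofReal (sum_two_mul_exp_le hL hδ hLδ (I + 1)))
    rw [ENNReal.ofReal_sum_of_nonneg fun j _ => by positivity]
    refine Finset.sum_le_sum fun j hj => ?_
    have hj : j ≤ I := Nat.lt_succ_iff.1 (Finset.mem_range.1 hj)
    rw [lintegral_finsetSum _ fun ι _ => (hprod j ι).const_mul _]
    have key : ∀ ι, ∫⁻ ω, ENNReal.ofReal (Real.exp (e j ι)) *
        ∏ v ∈ Finset.range (N * 2 ^ (I - j)), F j ι (ω (N * 2 ^ (I - j) - N + v))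
          ∂Measure.infinitePi (fun _ => ν) ≤ ENNReal.ofReal (Real.exp (-(3 * L * (j + 1)))) := by
      intro ι
      obtain ⟨hb, hquad, hexp, -⟩ := h j hj ι
      -- The coefficient `a` may be negative. A negative value would nonetheless force the
      -- expectation of a strictly positive function to vanish.
      have hnn : ∀ h, 0 ≤ 1 + a j ι * hbeMean k ν hash P x h + b j ι * hbeSqMean k ν hash P x h := by
        intro h'
        by_contra hlt
        have h1 := expect_hbeLaw_le (k := k) (ν := ν) (hash := hash) (P := P) (x := x) hk h'
          (fun z => (Real.exp_pos (s j ι * min z (24 * M ^ 3 / ε / 2 ^ (I - j)))).le) hquad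
        rw [ENNReal.ofReal_of_nonpos (not_le.1 hlt).le, nonpos_iff_eq_zero] at h1
        have h2 := ENNReal.tsum_eq_zero.1 h1
        obtain ⟨z, hz⟩ := (hbeLaw k ν hash P h' x).support_nonempty
        rcases mul_eq_zero.1 (h2 z) with h3 | h3
        · exact hz h3
        · exact (ENNReal.ofReal_pos.2 (Real.exp_pos _)).ne' h3
      have hle := lintegral_quadratic_hbe_le hm hb hmean hV hnn
      rw [lintegral_const_mul _ (hprod j ι), lintegral_prod_range_infinitePi ν (hFm j ι)]
      calc _ ≤ ENNReal.ofReal (Real.exp (e j ι)) * ENNReal.ofReal (Real.exp (a j ι * kde k P x +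
            b j ι * (M ^ 3 * kde k P x * √(kde k P x)))) ^ (N * 2 ^ (I - j)) := by gcongr
        _ = ENNReal.ofReal (Real.exp (e j ι + (N * 2 ^ (I - j) : ℕ) * (a j ι * kde k P x +
            b j ι * (M ^ 3 * kde k P x * √(kde k P x))))) := by
          rw [← ENNReal.ofReal_pow (Real.exp_pos _).le, ← ENNReal.ofReal_mul (Real.exp_pos _).le,
            ← Real.exp_nat_mul, ← Real.exp_add]
        _ ≤ _ := ENNReal.ofReal_le_ofReal (Real.exp_le_exp.2 hexp)
    refine (Finset.sum_le_sum fun ι _ => key ι).trans (le_of_eq ?_)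
    rw [Fintype.sum_bool, ← two_mul, ENNReal.ofReal_mul (by norm_num), ENNReal.ofReal_ofNat]

end Failure

/-- Rounding up costs at most one more unit of `D * L / ε ^ 2 ≥ 1`, and `2 ^ I ≤ 3 / √μ`; so the
constant is 36865 · 3 · 2. -/
theorem count_mul_le {D ε L μ : ℝ} (hD : 1 ≤ D) (hε : 0 < ε) (hε1 : ε ≤ 1) (hL : 1 ≤ L)
    (hμ : 0 < μ) {I : ℕ} (hI : μ * 4 ^ I ≤ 8) :
    ((⌈36864 * D * L / ε ^ 2⌉₊ * 2 ^ (I + 1) : ℕ) : ℝ) ≤ 221190 * (D * (1 / ε ^ 2) * (1 / √μ) * L) := by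
  have h1 : 1 ≤ D * L / ε ^ 2 := by
    rw [one_le_div (by positivity)]
    nlinarith [pow_le_one₀ hε.le hε1 (n := 2)]
  have h2 : (⌈36864 * D * L / ε ^ 2⌉₊ : ℝ) ≤ 36865 * (D * L / ε ^ 2) := by
    have := (Nat.ceil_lt_add_one (show 0 ≤ 36864 * D * L / ε ^ 2 by positivity)).le
    have e : 36864 * D * L / ε ^ 2 = 36864 * (D * L / ε ^ 2) := by ring
    linarith
  have hs : 0 < √μ := Real.sqrt_pos.2 hμ
  have h3 : (2 : ℝ) ^ I ≤ 3 * (1 / √μ) := by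
    rw [mul_one_div, le_div_iff₀ hs]
    refine (abs_le_of_sq_le_sq' ?_ (by norm_num)).2
    have : ((2 : ℝ) ^ I) ^ 2 = 4 ^ I := by rw [← pow_mul, mul_comm, pow_mul]; norm_num
    rw [mul_pow, Real.sq_sqrt hμ.le, this]
    linarith
  push_cast
  rw [pow_succ (2 : ℝ)]
  calc _ ≤ 36865 * (D * L / ε ^ 2) * (3 * (1 / √μ) * 2) := by gcongr
    _ = _ := by ring

end

/-! ### Assembly of the theorem. -/

theorem theorem1p4 :
    ∃ C : ℝ, 0 < C ∧
      ∀ (𝓕 : Set (ℝ → ℝ → ℝ)) (E : Prog 𝓕), ∃ A : Prog 𝓕,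
        ∀ (d n : ℕ) (k : EuclideanSpace ℝ (Fin d) → EuclideanSpace ℝ (Fin d) → ℝ)
          (P : Fin n → EuclideanSpace ℝ (Fin d)) (𝒬 : Set (EuclideanSpace ℝ (Fin d)))
          (H : Type u) [MeasurableSpace H] (ν : Measure H) [IsProbabilityMeasure ν]
          (B : Type v) (hash : H → EuclideanSpace ℝ (Fin d) → B)
          (M : ℝ) (T : ℕ) (τ ε δ : ℝ),
          0 < n → (∀ x y, k x y ∈ Set.Icc (0 : ℝ) 1) →
          MeasurableCollisions hash P 𝒬 →
          1 ≤ M → IsScaleFree k ν hash P 𝒬 (1 / 2) M →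
          1 ≤ T → HasComplexity E k ν hash P 𝒬 T →
          τ ∈ Set.Ioc (0 : ℝ) 1 → ε ∈ Set.Ioc (0 : ℝ) 1 → δ ∈ Set.Ioc (0 : ℝ) 1 →
          ∃ (Ω : Type u) (_ : MeasurableSpace Ω) (ℙ : Measure Ω) (_ : IsProbabilityMeasure ℙ)
            (image : Ω → Cells),
            SolvesKDE A ℙ image k P 𝒬 τ ε δ
              (fun μ => C * (M ^ 3 * (1 / ε ^ 2) * (1 / √μ) * max 1 (Real.log (1 / δ)) * T))
              (C * (M ^ 3 * (1 / ε ^ 2) * (1 / √τ) * max 1 (Real.log (1 / δ)) * (T * n))) := by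
  -- The 24 is 1 + 18 + 5: the time of `E`, the overhead per sample and the start-up, all absorbed
  -- by `T ≥ 1`. It covers the space overhead as well.
  refine ⟨24 * 221190, by norm_num, fun 𝓕 E => ⟨scanProg E, ?_⟩⟩
  intro d n k P 𝒬 H _ ν _ B hash M T τ ε δ hn hk hmeas hM hsf hT hE hτ hε hδ
  obtain ⟨table, htable⟩ := hE
  obtain ⟨K, hK, hK8, -⟩ := exists_level hτ.1 hτ.2
  set L : ℝ := max 1 (Real.log (1 / δ)) with hLdef
  have hL : 1 ≤ L := le_max_left _ _
  have hD : 1 ≤ M ^ 3 := one_le_pow₀ hM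
  set N : ℕ := ⌈36864 * M ^ 3 * L / ε ^ 2⌉₊ with hNdef
  have hN : 36864 * M ^ 3 * L ≤ N * ε ^ 2 := by
    have hε2 := pow_pos hε.1 2
    rw [← div_le_iff₀ hε2]
    exact Nat.le_ceil _
  have hNpos : 0 < N := Nat.ceil_pos.2 (by have := hε.1; positivity)
  set p := levelScan N (24 * M ^ 3 / ε)
  set J : ℕ := N * 2 ^ (K + 1) - N with hJ
  have hstored : ∀ ω : ℕ → H, p.StoredAs (scanImage p J (T * n) fun j => table (ω j)) J (T * n)
      fun j => table (ω j) := fun ω => storedAs_scanImage p J (T * n) fun j => (htable (ω j)).1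
  have hT' : (1 : ℝ) ≤ T := by exact_mod_cast hT
  have htime : ∀ μ : ℝ, 0 < μ → ∀ I : ℕ, μ * 4 ^ I ≤ 8 →
      (((N * 2 ^ (I + 1) - N) * (T + 18) + 5 : ℕ) : ℝ) ≤
        24 * 221190 * (M ^ 3 * (1 / ε ^ 2) * (1 / √μ) * L * T) := by
    intro μ hμ I hI
    have h1 := count_mul_le hD hε.1 hε.2 hL hμ hI
    rw [← hNdef] at h1
    have h2 : (N * 2 ^ (I + 1) - N) * (T + 18) + 5 ≤ 24 * (N * 2 ^ (I + 1) * T) := by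
      have h3 : 1 ≤ N * 2 ^ (I + 1) := Nat.mul_pos hNpos (by positivity)
      calc _ ≤ N * 2 ^ (I + 1) * (T + 18) + 5 := by gcongr; omega
        _ ≤ N * 2 ^ (I + 1) * (T + 18 * T) + 5 * (N * 2 ^ (I + 1) * T) := by
            gcongr
            · omega
            · have := Nat.mul_le_mul h3 hT
              omega
        _ = _ := by ring
    calc _ ≤ ((24 * (N * 2 ^ (I + 1) * T) : ℕ) : ℝ) := by exact_mod_cast h2
      _ = 24 * (((N * 2 ^ (I + 1) : ℕ) : ℝ) * T) := by push_cast; ring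
      _ ≤ 24 * ((221190 * (M ^ 3 * (1 / ε ^ 2) * (1 / √μ) * L)) * T) := by gcongr
      _ = _ := by ring
  refine ⟨ℕ → H, inferInstance, Measure.infinitePi fun _ => ν, inferInstance,
    fun ω => scanImage p J (T * n) fun j => table (ω j), ?_, ?_, ?_⟩
  · intro x hx μ hμ hkde
    have hμ0 : 0 < μ := hτ.1.trans_le hμ.1
    obtain ⟨I, hI, hI8, hImin⟩ := exists_level hμ0 hμ.2
    have hIK : I ≤ K := hImin K (hK.trans (by have := hμ.1; gcongr))
    have hlow : ∀ i, M⁻¹ * √(k x (P i)) ≤ collisionProb ν hash x (P i) := fun i => by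
      rw [Real.sqrt_eq_rpow]
      exact (hsf x hx i).1
    have hup : ∀ i, collisionProb ν hash x (P i) ≤ M * √(k x (P i)) := fun i => by
      rw [Real.sqrt_eq_rpow]
      exact (hsf x hx i).2
    obtain ⟨g, hgm, hg, hgδ⟩ := exists_measurable_failProb_le (hmeas x hx) (fun x y => (hk x y).1)
      hM hlow hup hε.1 hε.2 hδ.1 hL (le_max_right _ _) hN (hkde ▸ hμ0) (hkde ▸ hI) (hkde ▸ hI8)
    rw [hkde] at hg
    -- The measurable majorant bounds the upper expectation, so measurability of the failure
    -- probability in `ω` is not needed.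
    refine (iInf₂_le_of_le g hgm (iInf_le _ fun ω => ?_)).trans hgδ
    refine le_trans (measure_mono ?_) ((run_scanProg_le_failProb E (hstored ω)
      (q := fun j => hbeLaw k ν hash P (ω j) x) (fun j _ => ((htable (ω j)).2 x hx).1)
      (fun j _ => ((htable (ω j)).2 x hx).2) {a | ε * μ ≤ |a - μ|}
      (k := N * 2 ^ (I + 1) - N) ?_).trans (hg ω))
    · rintro r (hr | hr)
      · exact Or.inl hr
      · refine Or.inr ?_
        have := (htime μ hμ0 I hI8).trans_lt hr
        exact_mod_cast this
    · have : N * 2 ^ (I + 1) ≤ N * 2 ^ (K + 1) :=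
        Nat.mul_le_mul_left _ (Nat.pow_le_pow_right (by omega) (by omega))
      omega
  · intro x hx ω r hr
    have := le_of_mem_support_run_scanProg E (hstored ω) (T := T)
      (fun j _ => ((htable (ω j)).2 x hx).2) r hr
    exact le_trans (by exact_mod_cast this) (htime τ hτ.1 K hK8)
  · refine ⟨2 + J * (T * n + 4), ?_, fun ω => storedIn_scanImage p J (T * n) _⟩
    have h1 := count_mul_le hD hε.1 hε.2 hL hτ.1 hK8
    rw [← hNdef] at h1
    have hTn : 1 ≤ T * n := Nat.mul_pos hT hn
    have h3 : 1 ≤ N * 2 ^ (K + 1) := Nat.mul_pos hNpos (by positivity)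
    have h2 : 2 + J * (T * n + 4) ≤ 24 * (N * 2 ^ (K + 1) * (T * n)) := by
      calc _ ≤ 2 + N * 2 ^ (K + 1) * (T * n + 4) := by gcongr; omega
        _ ≤ 19 * (N * 2 ^ (K + 1) * (T * n)) + N * 2 ^ (K + 1) * (T * n + 4 * (T * n)) := by
            have := Nat.mul_le_mul h3 hTn
            gcongr
            · omega
            · omega
        _ = _ := by ring
    calc _ ≤ ((24 * (N * 2 ^ (K + 1) * (T * n)) : ℕ) : ℝ) := by exact_mod_cast h2
      _ = 24 * (((N * 2 ^ (K + 1) : ℕ) : ℝ) * (T * n)) := by push_cast; ring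
      _ ≤ 24 * ((221190 * (M ^ 3 * (1 / ε ^ 2) * (1 / √τ) * L)) * (T * n)) := by gcongr
      _ = _ := by ring
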